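/- Consider the experts problem with $N\ge 1$ experts: an oblivious adversary fixes loss vectors $\ell_1,\dots,\ell_T\in[0,1]^N$; in round $t$ the learner draws an expert $i_t$ from a distribution $p_t$ on $\{1,\dots,N\}$ that depends only on $\ell_1,\dots,\ell_{t-1}$, suffers the loss $\ell_{t,i_t}$, and then observes $\ell_t$. Let $L_T^*=\min_i\sum_{t=1}^T\ell_{t,i}$; the expected regret is $\mathbb E\big[\sum_{t=1}^T\ell_{t,i_t}\big]-L_T^*$. For a probability distribution $\mathcal D$ on $\mathbb R$, follow the perturbed leader (FTPL) with perturbation $\mathcal D$ plays $p_t=\nabla\tilde\Phi_{\mathcal D}\big(\sum_{s<t}\ell_s\big)$, where $\tilde\Phi_{\mathcal D}(L)=\mathbb E\big[\min_i(L_i-Z_i)\big]$ with $Z_1,\dots,Z_N$ i.i.d. from $\mathcal D$. There is an absolute constant $C>0$ such that for every $N\ge1$, every $L^*\ge0$ and each of the five families - Gamma (shape and rate positive), - Gumbel (location real, scale positive), - Fréchet (location $0$, shape $>1$, scale positive), - Weibull (scale and shape positive), - Pareto (scale and shape positive), there are parameters, depending only on $N$ and $L^*$, such that for the corresponding $\mathcal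 D$ the potential $\tilde\Phi_{\mathcal D}$ is concave and differentiable with gradient in the probability simplex, and FTPL with perturbation $\mathcal D$ has expected regret at most $$C\left(\sqrt{L^*\log N}+\log N\right)$$ for every $T$ and every loss sequence with $L_T^*=L^*$. This rate is optimal: there is an absolute constant $c>0$ such that for every $N\ge1$ and $L^*\ge0$, for all sufficiently large $T$, and for every randomized algorithm, some sequence $\ell_1,\dots,\ell_T\in[0,1]^N$ with $L_T^*=L^*$ makes its expected regret at least $c\left(\sqrt{L^*\log N}+\log N\right)$. -/

import Mathlib

open MeasureTheory ProbabilityTheory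

/-! ### The experts problem -/

/-- A randomized online learning algorithm for `N` experts with full information: in each round
`t` (rounds are numbered from `0`) it maps the `t` loss vectors observed so far to the probability
distribution from which it draws its next expert. -/
def ExpertsAlgorithm (N : ℕ) : Type :=
  (t : ℕ) → (Fin t → Fin N → ℝ) → stdSimplex ℝ (Fin N)

/-- The loss-only setting: in each of the `T` rounds the loss vector lies in `[0, 1]^N`. -/
def IsLossSequence {N : ℕ} (T : ℕ) (l : ℕ → Fin N → ℝ) : Prop :=
  ∀ t < T, ∀ i, l t i ∈ Set.Icc (0 : ℝ) 1

/-- The cumulative loss of the best expert in hindsight after `T` rounds. -/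
noncomputable def bestLoss {N : ℕ} (T : ℕ) (l : ℕ → Fin N → ℝ) : ℝ :=
  ⨅ i, ∑ t ∈ Finset.range T, l t i

/-- The expected regret after `T` rounds against the (oblivious) loss sequence `l`. The expert
`i` is drawn in round `t` with probability `(A t _) i`, so the expected loss of the round is
`∑ i, (A t _) i * l t i`. -/
noncomputable def expectedRegret {N : ℕ} (A : ExpertsAlgorithm N) (T : ℕ)
    (l : ℕ → Fin N → ℝ) : ℝ :=
  ∑ t ∈ Finset.range T,
      ∑ i, ((A t (fun s : Fin t => l s)) : Fin N → ℝ) i * l t i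
    - bestLoss T l

/-! ### Gradient based prediction and follow the perturbed leader -/

/-- `p` is the gradient map of a potential `Φ` that is admissible for the gradient based prediction
algorithm: `Φ` is concave and everywhere differentiable, and its gradient `p L` at `L` always lies
in the probability simplex. -/
structure IsGBPAPotential {N : ℕ} (Φ : (Fin N → ℝ) → ℝ)
    (p : (Fin N → ℝ) → stdSimplex ℝ (Fin N)) : Prop where
  concave : ConcaveOn ℝ Set.univ Φ
  hasGradient : ∀ L : Fin N → ℝ,
    HasFDerivAt Φ
      (∑ i, ((p L : stdSimplex ℝ (Fin N)) : Fin N → ℝ) i •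
        (ContinuousLinearMap.proj i : (Fin N → ℝ) →L[ℝ] ℝ)) L

/-- The gradient based prediction algorithm with gradient map `p`: it draws the next expert from
`p L`, where `L` is the vector of cumulative losses so far. -/
noncomputable def gbpa {N : ℕ} (p : (Fin N → ℝ) → stdSimplex ℝ (Fin N)) : ExpertsAlgorithm N :=
  fun _ h => p (∑ s, h s)

/-- The potential of follow the perturbed leader with `N` independent perturbations of law `D`,
that is `L ↦ 𝔼 [min_i (L i - Z i)]`. -/
noncomputable def ftplPotential (N : ℕ) (D : Measure ℝ) (L : Fin N → ℝ) : ℝ :=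
  ∫ Z : Fin N → ℝ, (⨅ i, (L i - Z i)) ∂(Measure.pi fun _ : Fin N => D)

/-- Follow the perturbed leader with perturbation law `D` is well defined, and its expected regret
is at most `R` for every number of rounds and every loss sequence whose best expert has cumulative
loss `Lstar`. The gradient map `p` is determined by `D`. -/
def FTPLRegretAtMost (N : ℕ) (D : Measure ℝ) (Lstar R : ℝ) : Prop :=
  ∃ p : (Fin N → ℝ) → stdSimplex ℝ (Fin N), IsGBPAPotential (ftplPotential N D) p ∧
    ∀ (T : ℕ) (l : ℕ → Fin N → ℝ), IsLossSequence T l → bestLoss T l = Lstar →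
      expectedRegret (gbpa p) T l ≤ R

/-! ### Perturbation distributions that are not in the library -/

/-- The Gumbel distribution with location `μ` and scale `β`; its distribution function is
`x ↦ exp (-exp (-(x - μ) / β))`. -/
noncomputable def gumbelMeasure (μ β : ℝ) : Measure ℝ :=
  volume.withDensity fun x =>
    ENNReal.ofReal (β⁻¹ * Real.exp (-((x - μ) / β + Real.exp (-((x - μ) / β)))))

/-- The Fréchet distribution with shape `α` and scale `s`; its distribution function is
`x ↦ exp (-(x / s) ^ (-α))` on `x > 0`. -/
noncomputable def frechetMeasure (α s : ℝ) : Measure ℝ :=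
  volume.withDensity fun x =>
    ENNReal.ofReal
      (if 0 < x then α / s * (x / s) ^ (-α - 1) * Real.exp (-(x / s) ^ (-α)) else 0)

/-- The Weibull distribution with scale `s` and shape `k`; its distribution function is
`x ↦ 1 - exp (-(x / s) ^ k)` on `x ≥ 0`. -/
noncomputable def weibullMeasure (s k : ℝ) : Measure ℝ :=
  volume.withDensity fun x =>
    ENNReal.ofReal
      (if 0 ≤ x then k / s * (x / s) ^ (k - 1) * Real.exp (-(x / s) ^ k) else 0)

/-! ### The rate -/

/-- The first-order rate `√(L* log N) + log N`. -/
noncomputable def firstOrderRate (N : ℕ) (Lstar : ℝ) : ℝ :=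
  √(Lstar * Real.log N) + Real.log N

/-!
**Upper bound.** Let `Z` have hazard rate at most `h ≤ 1 / 2`, so that its tail loses at most the
fraction `h` within a unit step. Given the other perturbations, expert `i` leads when `Z i` exceeds
a threshold, which a loss vector in `[0, 1]^N` raises by at most `1`. Hence its probability of
leading drops at most by the factor `1 - h` (`mul_leaderProb_le`). As the potential `Φ` is concave,
each round raises it by at least `1 - h` times the expected loss of the learner
(`mul_learnerLoss_le`), and `Φ (L_T) - Φ 0 ≤ L* + 𝔼 [max_i Z_i] - 𝔼 [Z_1]`. The regret is thus at
most `2 h L* + 2 B`, where `B` bounds the expected range of the perturbations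
(`IsStablePerturbation.expectedRegret_le`). Each of the five families contains, for every such `h`,
a law with hazard rate at most `h` and `B` of the order `log N / h`: exponential laws among the
Gamma and Weibull laws, the Gumbel laws of scale `1 / h`, and the Pareto and Fréchet laws whose
shape is of the order `log N` and whose scale is of the order `log N / h`. Then `h` is chosen of
the order `min 1 √(log N / L*)` (`tunedHazard`).

**Lower bound.** The adversary knows the distribution that the algorithm plays next, so it may
choose the losses adaptively. Let `k = Nat.log 2 N`. It keeps a set of surviving experts with equal
cumulative loss and splits it in halves `k` times. For small `L*` it spares the half with less mass
and gives loss `1` to all other experts, so that the learner loses `1 / 2` per round and the best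
expert nothing (`exists_halving`). For large `L*` the halves play a block of `m` rounds with
opposite losses `(1 ± ε) / 2` before the worse half is discarded. The signs `ε` are chosen to
derandomize the bound `𝔼 |S_m| ≥ √(m / 3)` for a random walk, which gains `√(m / 3) / 2` per block
(`exists_block`, `exists_blocks`). Rounds with equal losses for all experts finally raise the best
loss to `L*` exactly (`exists_pad`).
-/

/-! ### Adaptive construction of loss sequences -/

section LowerBound

variable {N : ℕ}

/-- The expected cumulative loss of the algorithm `A` in the first `T` rounds. -/
noncomputable def learnerLoss (A : ExpertsAlgorithm N) (T : ℕ) (l : ℕ → Fin N → ℝ) : ℝ :=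
  ∑ t ∈ Finset.range T, ∑ i, ((A t (fun s : Fin t => l s)) : Fin N → ℝ) i * l t i

/-- The cumulative loss of expert `i` in the first `T` rounds. -/
noncomputable def cumLoss (T : ℕ) (l : ℕ → Fin N → ℝ) (i : Fin N) : ℝ :=
  ∑ t ∈ Finset.range T, l t i

lemma expectedRegret_eq (A : ExpertsAlgorithm N) (T : ℕ) (l : ℕ → Fin N → ℝ) :
    expectedRegret A T l = learnerLoss A T l - bestLoss T l := rfl

lemma bestLoss_le_cumLoss (T : ℕ) (l : ℕ → Fin N → ℝ) (i : Fin N) :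
    bestLoss T l ≤ cumLoss T l i :=
  ciInf_le (Set.finite_range _).bddBelow i

lemma learnerLoss_congr (A : ExpertsAlgorithm N) {T : ℕ} {l l' : ℕ → Fin N → ℝ}
    (h : ∀ t < T, l t = l' t) : learnerLoss A T l = learnerLoss A T l' := by
  refine Finset.sum_congr rfl fun t ht => ?_
  have ht := Finset.mem_range.1 ht
  have e : (fun s : Fin t => l s) = fun s : Fin t => l' s :=
    funext fun s => h s (s.2.trans ht)
  rw [e, h t ht]

lemma cumLoss_congr {T : ℕ} {l l' : ℕ → Fin N → ℝ}
    (h : ∀ t < T, l t = l' t) : cumLoss T l = cumLoss T l' := by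
  funext i
  exact Finset.sum_congr rfl fun t ht => by rw [h t (Finset.mem_range.1 ht)]

/-- A loss sequence of length `T` can be continued by an arbitrary loss vector `v`, chosen with
knowledge of the distribution that the algorithm plays in the next round. -/
lemma exists_extend (A : ExpertsAlgorithm N) {T : ℕ} {l : ℕ → Fin N → ℝ}
    (hl : IsLossSequence T l) (v : Fin N → ℝ) (hv : ∀ i, v i ∈ Set.Icc (0 : ℝ) 1) :
    ∃ l', IsLossSequence (T + 1) l' ∧ (∀ i, cumLoss (T + 1) l' i = cumLoss T l i + v i) ∧
      learnerLoss A (T + 1) l' =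
        learnerLoss A T l + ∑ i, ((A T (fun s : Fin T => l s)) : Fin N → ℝ) i * v i := by
  have hlt : ∀ t < T, Function.update l T v t = l t := fun t ht =>
    Function.update_of_ne ht.ne _ _
  refine ⟨Function.update l T v, ?_, ?_, ?_⟩
  · intro t ht i
    rcases Nat.lt_succ_iff_lt_or_eq.1 ht with h | rfl
    · rw [hlt t h]; exact hl t h i
    · simpa using hv i
  · intro i
    have := congrFun (cumLoss_congr hlt) i
    simp only [cumLoss] at this ⊢
    rw [Finset.sum_range_succ, this]; simp
  · have := learnerLoss_congr A hlt
    simp only [learnerLoss] at this ⊢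
    rw [Finset.sum_range_succ, this]
    have e : (fun s : Fin T => Function.update l T v s) = fun s : Fin T => l s :=
      funext fun s => hlt s s.2
    rw [e]; simp

/-- Rounds in which all experts suffer the same loss change no regret, so that the loss of the
best expert can be raised to a prescribed value. -/
lemma exists_pad [NeZero N] (A : ExpertsAlgorithm N) {T₁ T : ℕ} {l : ℕ → Fin N → ℝ}
    {Lstar R x : ℝ} {i₀ : Fin N} (hl : IsLossSequence T₁ l) (hx : cumLoss T₁ l i₀ ≤ x)
    (hxL : x ≤ Lstar) (hR : R ≤ learnerLoss A T₁ l - x)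
    (hT : T₁ + ⌈Lstar⌉₊ + 1 ≤ T) :
    ∃ l' : ℕ → Fin N → ℝ, IsLossSequence T l' ∧ bestLoss T l' = Lstar ∧
      R ≤ expectedRegret A T l' := by
  obtain ⟨n, rfl⟩ : ∃ n, T = T₁ + n := ⟨T - T₁, by omega⟩
  have hn : (0 : ℝ) < n := by exact_mod_cast (by omega : 0 < n)
  have hLn : Lstar ≤ n := (Nat.le_ceil _).trans (by exact_mod_cast (by omega : ⌈Lstar⌉₊ ≤ n))
  have hb0 : 0 ≤ bestLoss T₁ l := by
    refine Real.iInf_nonneg fun i => Finset.sum_nonneg fun t ht => ?_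
    exact (hl t (Finset.mem_range.1 ht) i).1
  have hbx := (bestLoss_le_cumLoss T₁ l i₀).trans hx
  set v : ℝ := (Lstar - bestLoss T₁ l) / n with hv
  have hnv : n * v = Lstar - bestLoss T₁ l := by rw [hv]; field_simp
  have hv0 : 0 ≤ v := div_nonneg (by linarith) hn.le
  have hv1 : v ≤ 1 := by rw [hv, div_le_one hn]; linarith
  let l' : ℕ → Fin N → ℝ := fun t => if t < T₁ then l t else fun _ => v
  have hlt : ∀ t < T₁, l' t = l t := fun t ht => if_pos ht
  have hge : ∀ t, l' (T₁ + t) = fun _ => v := fun t => if_neg (by omega)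
  have hcum : ∀ i, ∑ t ∈ Finset.range (T₁ + n), l' t i = cumLoss T₁ l i + n * v := by
    intro i
    rw [Finset.sum_range_add, ← congrFun (cumLoss_congr hlt) i]
    simp [hge, cumLoss]
  have hlearn : learnerLoss A (T₁ + n) l' = learnerLoss A T₁ l + n * v := by
    rw [← learnerLoss_congr A hlt, learnerLoss, Finset.sum_range_add]
    simp only [hge, ← Finset.sum_mul]
    simp [learnerLoss]
  have hbest : bestLoss (T₁ + n) l' = Lstar := by
    have : bestLoss (T₁ + n) l' = bestLoss T₁ l + n * v := by
      simp only [bestLoss, hcum]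
      rw [← ciInf_add (Set.finite_range _).bddBelow]
      rfl
    rw [this, hnv]; ring
  refine ⟨l', ?_, hbest, ?_⟩
  · intro t ht i
    by_cases h : t < T₁
    · rw [hlt t h]; exact hl t h i
    · simp only [l', if_neg h]; exact ⟨hv0, hv1⟩
  · rw [expectedRegret_eq, hbest, hlearn, hnv]
    linarith

/-! ### Halving -/

lemma exists_halves {α : Type*} [DecidableEq α] {S : Finset α} {n : ℕ} (h : 2 ^ (n + 1) ≤ S.card) :
    ∃ S₁ S₂ : Finset α, S₁ ⊆ S ∧ S₂ ⊆ S ∧ Disjoint S₁ S₂ ∧ 2 ^ n ≤ S₁.card ∧ 2 ^ n ≤ S₂.card := by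
  rw [pow_succ] at h
  obtain ⟨S₁, h₁, hc⟩ := Finset.exists_subset_card_eq (show 2 ^ n ≤ S.card by omega)
  refine ⟨S₁, S \ S₁, h₁, Finset.sdiff_subset, Finset.disjoint_sdiff, hc.ge, ?_⟩
  rw [Finset.card_sdiff_of_subset h₁]; omega

/-- In each round the adversary spares that half of the experts without loss on which the learner
puts less mass: after `k` rounds an expert without loss is left, and the learner has lost at
least `k / 2`. -/
lemma exists_halving (A : ExpertsAlgorithm N) {k : ℕ} (hk : 2 ^ k ≤ N) :
    ∃ l : ℕ → Fin N → ℝ, IsLossSequence k l ∧ (∃ i, cumLoss k l i = 0) ∧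
      (k : ℝ) / 2 ≤ learnerLoss A k l := by
  suffices H : ∀ t ≤ k, ∃ l : ℕ → Fin N → ℝ, IsLossSequence t l ∧
      (∃ S : Finset (Fin N), 2 ^ (k - t) ≤ S.card ∧ ∀ i ∈ S, cumLoss t l i = 0) ∧
      (t : ℝ) / 2 ≤ learnerLoss A t l by
    obtain ⟨l, hl, ⟨S, hS, h0⟩, hA⟩ := H k le_rfl
    obtain ⟨i, hi⟩ := Finset.card_pos.1 (lt_of_lt_of_le (by positivity) hS)
    exact ⟨l, hl, ⟨i, h0 i hi⟩, hA⟩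
  intro t
  induction t with
  | zero =>
    refine fun _ => ⟨0, fun t ht => absurd ht (by omega), ⟨Finset.univ, by simpa using hk, ?_⟩, ?_⟩
    · simp [cumLoss]
    · simp [learnerLoss]
  | succ t ih =>
    intro ht
    obtain ⟨l, hl, ⟨S, hS, h0⟩, hA⟩ := ih (by omega)
    rw [show k - t = k - (t + 1) + 1 by omega] at hS
    obtain ⟨S₁, S₂, h₁, h₂, hd, hc₁, hc₂⟩ := exists_halves hS
    set p := A t (fun s : Fin t => l s) with hp
    have hle : ∑ i ∈ S₁, (p : Fin N → ℝ) i + ∑ i ∈ S₂, (p : Fin N → ℝ) i ≤ 1 := by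
      rw [← Finset.sum_union hd, ← stdSimplex.sum_eq_one p]
      exact Finset.sum_le_sum_of_subset_of_nonneg (Finset.subset_univ _) fun i _ _ => p.2.1 i
    obtain ⟨S', hS', hc', hm⟩ : ∃ S' ⊆ S, 2 ^ (k - (t + 1)) ≤ S'.card ∧
        ∑ i ∈ S', (p : Fin N → ℝ) i ≤ 1 / 2 := by
      rcases le_total (∑ i ∈ S₁, (p : Fin N → ℝ) i) (∑ i ∈ S₂, (p : Fin N → ℝ) i) with h | h
      · exact ⟨S₁, h₁, hc₁, by linarith⟩
      · exact ⟨S₂, h₂, hc₂, by linarith⟩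
    obtain ⟨l', hl', hcum, hlearn⟩ := exists_extend A hl (fun i => if i ∈ S' then 0 else 1)
      (fun i => by split_ifs <;> simp)
    refine ⟨l', hl', ⟨S', hc', fun i hi => ?_⟩, ?_⟩
    · rw [hcum, h0 i (hS' hi)]; simp [hi]
    · have e : ∑ i, (p : Fin N → ℝ) i * (if i ∈ S' then (0 : ℝ) else 1)
          = 1 - ∑ i ∈ S', (p : Fin N → ℝ) i := by
        have h : ∀ i, (p : Fin N → ℝ) i * (if i ∈ S' then (0 : ℝ) else 1) =
            (p : Fin N → ℝ) i - (if i ∈ S' then (p : Fin N → ℝ) i else 0) := by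
          intro i; split_ifs <;> ring
        simp [h]
      rw [hlearn, ← hp, e]
      push_cast
      linarith

/-! ### Blocks of balanced losses -/

/-- A lower bound for `𝔼 |s + S_n|`, where `S_n` is the sum of `n` independent random signs. It is
the expectation of `3/2 * x ^ 2 / a - 1/2 * x ^ 4 / a ^ 3 ≤ |x|` at `x = s + S_n`. -/
noncomputable def walkPotential (a : ℝ) (n : ℕ) (s : ℝ) : ℝ :=
  3 / 2 * (s ^ 2 + n) / a - 1 / 2 * (s ^ 4 + 6 * s ^ 2 * n + 3 * n ^ 2 - 2 * n) / a ^ 3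

lemma walkPotential_succ (a : ℝ) (n : ℕ) (s : ℝ) :
    walkPotential a (n + 1) s = (walkPotential a n (s + 1) + walkPotential a n (s - 1)) / 2 := by
  simp only [walkPotential]; push_cast; ring

lemma walkPotential_zero_le {a : ℝ} (ha : 0 < a) (s : ℝ) : walkPotential a 0 s ≤ |s| := by
  obtain ⟨y, hy, hs⟩ : ∃ y, 0 ≤ y ∧ |s| = y * a :=
    ⟨|s| / a, by positivity, by field_simp⟩
  have h2 : s ^ 2 = (y * a) ^ 2 := by rw [← hs, sq_abs]
  have h4 : s ^ 4 = (y * a) ^ 4 := by rw [show s ^ 4 = (s ^ 2) ^ 2 by ring, h2]; ring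
  have e : walkPotential a 0 s = a * (3 / 2 * y ^ 2 - 1 / 2 * y ^ 4) := by
    simp only [walkPotential, h2, h4]; field_simp; push_cast; ring
  rw [e, hs]
  nlinarith [mul_nonneg (mul_nonneg ha.le hy)
    (mul_nonneg (sq_nonneg (y - 1)) (by linarith : 0 ≤ y + 2))]

lemma sqrt_le_walkPotential {m : ℕ} (hm : 0 < m) :
    √(m / 3) ≤ walkPotential √(3 * m) m 0 := by
  have hm' : (0 : ℝ) < m := by exact_mod_cast hm
  set b := √((m : ℝ) / 3) with hb
  have hb0 : 0 < b := Real.sqrt_pos.2 (by positivity)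
  have hm3 : (m : ℝ) = 3 * b ^ 2 := by rw [hb, Real.sq_sqrt (by positivity)]; ring
  have ha : √(3 * (m : ℝ)) = 3 * b := by
    rw [hm3, show 3 * (3 * b ^ 2) = (3 * b) ^ 2 by ring, Real.sqrt_sq (by positivity)]
  rw [ha, walkPotential, hm3]
  have : 3 / 2 * (0 ^ 2 + 3 * b ^ 2) / (3 * b) -
      1 / 2 * (0 ^ 4 + 6 * 0 ^ 2 * (3 * b ^ 2) + 3 * (3 * b ^ 2) ^ 2 - 2 * (3 * b ^ 2)) /
        (3 * b) ^ 3 = b + 1 / (9 * b) := by field_simp; ring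
  rw [this]
  have : 0 < 1 / (9 * b) := by positivity
  linarith

/-- A block of `m` rounds in which the experts of `S₁` and of `S₂` suffer the losses `(1 ± ε) / 2`
and all others `1 / 2`. Since a choice of the signs `ε` at random would leave the learner with
loss `1 / 2` per round, some choice does so while `walkPotential` does not increase. -/
lemma exists_block (A : ExpertsAlgorithm N) {T : ℕ} {l : ℕ → Fin N → ℝ} (hl : IsLossSequence T l)
    {S₁ S₂ : Finset (Fin N)} (hd : Disjoint S₁ S₂) {x : ℝ} (h₁ : ∀ i ∈ S₁, cumLoss T l i = x)
    (h₂ : ∀ i ∈ S₂, cumLoss T l i = x) (a : ℝ) (m : ℕ) :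
    ∀ n ≤ m, ∃ l' : ℕ → Fin N → ℝ, IsLossSequence (T + n) l' ∧ ∃ s : ℝ,
      (∀ i ∈ S₁, cumLoss (T + n) l' i = x + n / 2 + s / 2) ∧
      (∀ i ∈ S₂, cumLoss (T + n) l' i = x + n / 2 - s / 2) ∧
      learnerLoss A T l + n / 2 + walkPotential a m 0 / 2 ≤
        learnerLoss A (T + n) l' + walkPotential a (m - n) s / 2 := by
  intro n
  induction n with
  | zero =>
    refine fun _ => ⟨l, hl, 0, fun i hi => ?_, fun i hi => ?_, ?_⟩
    · simp [h₁ i hi]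
    · simp [h₂ i hi]
    · simp
  | succ n ih =>
    intro hn
    obtain ⟨l', hl', s, hc₁, hc₂, hA⟩ := ih (by omega)
    rw [show m - n = m - (n + 1) + 1 by omega, walkPotential_succ] at hA
    set p := A (T + n) (fun s : Fin (T + n) => l' s) with hp
    set r : ℝ := (∑ i ∈ S₁, (p : Fin N → ℝ) i - ∑ i ∈ S₂, (p : Fin N → ℝ) i) / 2 with hr
    obtain ⟨ε, hε, hstep⟩ : ∃ ε : ℝ, (ε = 1 ∨ ε = -1) ∧
        (walkPotential a (m - (n + 1)) (s + 1) + walkPotential a (m - (n + 1)) (s - 1)) / 2 / 2 ≤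
          ε * r + walkPotential a (m - (n + 1)) (s + ε) / 2 := by
      by_contra! h
      have h1 := h 1 (Or.inl rfl)
      have h2 := h (-1) (Or.inr rfl)
      rw [← sub_eq_add_neg] at h2
      linarith
    let v : Fin N → ℝ := fun i => 1 / 2 + ε / 2 * ((if i ∈ S₁ then 1 else 0) -
      (if i ∈ S₂ then 1 else 0))
    have hv₁ : ∀ i ∈ S₁, v i = 1 / 2 + ε / 2 := fun i hi => by
      simp [v, hi, Finset.disjoint_left.1 hd hi]
    have hv₂ : ∀ i ∈ S₂, v i = 1 / 2 - ε / 2 := fun i hi => by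
      simp [v, hi, Finset.disjoint_right.1 hd hi]; ring
    have hv : ∀ i, v i ∈ Set.Icc (0 : ℝ) 1 := by
      intro i
      simp only [v]
      rcases hε with rfl | rfl <;> split_ifs <;> norm_num
    have hpv : ∑ i, (p : Fin N → ℝ) i * v i = 1 / 2 + ε * r := by
      have : ∀ i, (p : Fin N → ℝ) i * v i = (p : Fin N → ℝ) i * (1 / 2) + ε / 2 *
          ((if i ∈ S₁ then (p : Fin N → ℝ) i else 0) -
            (if i ∈ S₂ then (p : Fin N → ℝ) i else 0)) := by
        intro i; simp only [v]; split_ifs <;> ring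
      simp only [this, Finset.sum_add_distrib, ← Finset.mul_sum, ← Finset.sum_mul,
        Finset.sum_sub_distrib]
      simp [hr]; ring
    obtain ⟨l'', hl'', hcum, hlearn⟩ := exists_extend A hl' v hv
    refine ⟨l'', hl'', s + ε, fun i hi => ?_, fun i hi => ?_, ?_⟩
    · rw [← add_assoc, hcum, hc₁ i hi, hv₁ i hi]; push_cast; ring
    · rw [← add_assoc, hcum, hc₂ i hi, hv₂ i hi]; push_cast; ring
    · rw [← add_assoc, hlearn, ← hp, hpv]; push_cast; linarith

/-- In each of `k` blocks of length `m` the better half of the surviving experts gains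
`√(m / 3) / 2` over the learner. -/
lemma exists_blocks (A : ExpertsAlgorithm N) {k m : ℕ} (hk : 2 ^ k ≤ N) (hm : 0 < m) :
    ∃ l : ℕ → Fin N → ℝ, IsLossSequence (k * m) l ∧ ∃ i, cumLoss (k * m) l i ≤ k * m / 2 ∧
      k * (√(m / 3) / 2) ≤ learnerLoss A (k * m) l - cumLoss (k * m) l i := by
  suffices H : ∀ j ≤ k, ∃ l : ℕ → Fin N → ℝ, IsLossSequence (j * m) l ∧
      ∃ S : Finset (Fin N), 2 ^ (k - j) ≤ S.card ∧ ∃ x : ℝ, (∀ i ∈ S, cumLoss (j * m) l i = x) ∧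
        x ≤ j * m / 2 ∧ j * (√(m / 3) / 2) ≤ learnerLoss A (j * m) l - x by
    obtain ⟨l, hl, S, hS, x, hx, hxm, hA⟩ := H k le_rfl
    obtain ⟨i, hi⟩ := Finset.card_pos.1 (lt_of_lt_of_le (by positivity) hS)
    exact ⟨l, hl, i, by rwa [hx i hi], by rwa [hx i hi]⟩
  intro j
  induction j with
  | zero =>
    refine fun _ => ⟨0, fun t ht => absurd ht (by omega), Finset.univ, by simpa using hk, 0, ?_⟩
    simp [cumLoss, learnerLoss]
  | succ j ih =>
    intro hj
    obtain ⟨l, hl, S, hS, x, hx, hxm, hA⟩ := ih (by omega)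
    rw [show k - j = k - (j + 1) + 1 by omega] at hS
    obtain ⟨S₁, S₂, h₁, h₂, hd, hc₁, hc₂⟩ := exists_halves hS
    obtain ⟨l', hl', s, hs₁, hs₂, hlearn⟩ := exists_block A hl hd (fun i hi => hx i (h₁ hi))
      (fun i hi => hx i (h₂ hi)) √(3 * m) m m le_rfl
    rw [Nat.sub_self] at hlearn
    have ha : 0 < √(3 * (m : ℝ)) := Real.sqrt_pos.2 (by positivity)
    have hU0 := walkPotential_zero_le ha s
    have hU := sqrt_le_walkPotential hm
    have hs0 := abs_nonneg s
    rw [Nat.succ_mul]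
    refine ⟨l', hl', ?_⟩
    obtain ⟨S', hc', hS'⟩ : ∃ S' : Finset (Fin N), 2 ^ (k - (j + 1)) ≤ S'.card ∧
        ∀ i ∈ S', cumLoss (j * m + m) l' i = x + m / 2 - |s| / 2 := by
      rcases le_total 0 s with h | h
      · exact ⟨S₂, hc₂, fun i hi => by rw [hs₂ i hi, abs_of_nonneg h]⟩
      · exact ⟨S₁, hc₁, fun i hi => by rw [hs₁ i hi, abs_of_nonpos h]; ring⟩
    refine ⟨S', hc', _, hS', ?_, ?_⟩
    · push_cast; linarith
    · push_cast; linarith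

/-! ### The lower bound on the regret -/

lemma log_le_two_mul_natLog (hN : 2 ≤ N) : Real.log N ≤ 2 * (Nat.log 2 N : ℕ) := by
  have hk : 1 ≤ Nat.log 2 N := Nat.log_pos (by norm_num) hN
  have hk' : (1 : ℝ) ≤ (Nat.log 2 N : ℕ) := by exact_mod_cast hk
  have h : (N : ℝ) ≤ 2 ^ (Nat.log 2 N + 1) := by
    exact_mod_cast (Nat.lt_pow_succ_log_self (by norm_num) N).le
  have h2 := Real.log_le_log (by positivity) h
  rw [Real.log_pow] at h2
  push_cast at h2
  nlinarith [Real.log_two_lt_d9]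

/-- The lower bound. With `k = Nat.log 2 N`, for `Lstar ≤ k` halving forces regret `k / 2`;
otherwise `k` blocks of length about `2 * Lstar / k` force regret of the order `√(k * Lstar)`. -/
theorem exists_regret_ge [NeZero N] {Lstar : ℝ} (hL : 0 ≤ Lstar) :
    ∃ T₀ : ℕ, ∀ T : ℕ, T₀ ≤ T → ∀ A : ExpertsAlgorithm N,
        ∃ l : ℕ → Fin N → ℝ, IsLossSequence T l ∧ bestLoss T l = Lstar ∧
          1 / 16 * firstOrderRate N Lstar ≤ expectedRegret A T l := by
  set k := Nat.log 2 N with hk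
  have hkN : 2 ^ k ≤ N := Nat.pow_log_le_self 2 (NeZero.ne N)
  have hk0 : (0 : ℝ) ≤ k := k.cast_nonneg
  have hlog : Real.log N ≤ 2 * k := by
    rcases Nat.lt_or_ge N 2 with h | h
    · have : N = 1 := by have := NeZero.ne N; omega
      subst this; simp
    · exact log_le_two_mul_natLog h
  have hmul : Lstar * Real.log N ≤ Lstar * (2 * k) := mul_le_mul_of_nonneg_left hlog hL
  rcases le_or_gt Lstar k with h | h
  · refine ⟨k + ⌈Lstar⌉₊ + 1, fun T hT A => ?_⟩
    obtain ⟨l, hl, ⟨i, hi⟩, hA⟩ := exists_halving A hkN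
    refine exists_pad A hl hi.le hL ?_ hT
    have : √(Lstar * Real.log N) ≤ 2 * k := by
      refine Real.sqrt_le_iff.2 ⟨by positivity, ?_⟩
      nlinarith
    rw [firstOrderRate]; linarith
  · rcases Nat.eq_zero_or_pos k with h0 | hkpos
    · refine ⟨0 + ⌈Lstar⌉₊ + 1, fun T hT A => ?_⟩
      refine exists_pad (T₁ := 0) (l := 0) (x := 0) (i₀ := 0) A (fun t ht => absurd ht (by omega))
        (by simp [cumLoss]) hL ?_ hT
      have hlog0 : Real.log N = 0 :=
        le_antisymm (by simpa [h0] using hlog) (Real.log_natCast_nonneg N)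
      simp [firstOrderRate, hlog0, learnerLoss]
    · have hkpos' : (1 : ℝ) ≤ k := by exact_mod_cast hkpos
      set m := ⌊2 * Lstar / k⌋₊ with hm
      have hq : (k : ℝ) * (2 * Lstar / k) = 2 * Lstar := by field_simp
      have hm_le : (m : ℝ) ≤ 2 * Lstar / k := Nat.floor_le (by positivity)
      have hm_gt : 2 * Lstar / k < m + 1 := Nat.lt_floor_add_one _
      have hkm : k * m / 2 ≤ Lstar := by nlinarith
      have hkm' : Lstar ≤ k * m := by nlinarith
      have hmpos : 0 < m := by
        rcases Nat.eq_zero_or_pos m with h0 | h0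
        · rw [h0] at hkm'; push_cast at hkm'; linarith
        · exact h0
      refine ⟨k * m + ⌈Lstar⌉₊ + 1, fun T hT A => ?_⟩
      obtain ⟨l, hl, i, hi, hA⟩ := exists_blocks A hkN hmpos
      refine exists_pad A hl le_rfl (hi.trans hkm) (le_trans ?_ hA) hT
      -- all terms are compared with `k * b`, where `b = √(m / 3)`
      set b := √((m : ℝ) / 3) with hb
      have hb0 : 0 ≤ b := Real.sqrt_nonneg _
      have hmb : (m : ℝ) = 3 * b ^ 2 := by rw [hb, Real.sq_sqrt (by positivity)]; ring
      have hb1 : 1 / 2 ≤ b := by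
        have : (1 : ℝ) ≤ m := by exact_mod_cast hmpos
        nlinarith
      have h1 : √(Lstar * Real.log N) ≤ 5 / 2 * (k * b) := by
        refine Real.sqrt_le_iff.2 ⟨by positivity, ?_⟩
        have : Lstar * (2 * k) ≤ k * (3 * b ^ 2) * (2 * k) := by
          rw [← hmb]; gcongr
        nlinarith [mul_nonneg (mul_nonneg hk0 hb0) (mul_nonneg hk0 hb0)]
      rw [firstOrderRate]
      nlinarith

end LowerBound

/-! ### The leader after perturbation -/

section PerturbedLeader

open Filter Topology

variable {N : ℕ}

/-- Drawing coordinate `i` afresh does not change the law of a vector with independent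
coordinates. -/
lemma pi_apply_eq_lintegral_update (D : Measure ℝ) [IsProbabilityMeasure D] (i : Fin N)
    {S : Set (Fin N → ℝ)} (hS : MeasurableSet S) :
    (Measure.pi fun _ : Fin N => D) S =
      ∫⁻ Z, D {z | Function.update Z i z ∈ S} ∂(Measure.pi fun _ : Fin N => D) := by
  have hm : Measurable fun Z : Fin N → ℝ => ∫⁻ z, S.indicator 1 (Function.update Z i z) ∂D := by
    rw [← lmarginal_singleton (μ := fun _ : Fin N => D)]
    exact (measurable_one.indicator hS).lmarginal _
  have key : ∀ f : (Fin N → ℝ) → ENNReal, Measurable f →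
      ∫⁻ Z, f Z ∂(Measure.pi fun _ : Fin N => D) =
        (lmarginal (fun _ : Fin N => D) (Finset.univ.erase i)
          (fun Z => ∫⁻ z, f (Function.update Z i z) ∂D)) 0 := by
    intro f hf
    rw [lintegral_eq_lmarginal_univ 0, lmarginal_erase' _ hf (Finset.mem_univ i)]
  rw [← lintegral_indicator_one hS, key _ (measurable_one.indicator hS)]
  have e : ∀ Z : Fin N → ℝ, D {z | Function.update Z i z ∈ S} =
      ∫⁻ z, S.indicator 1 (Function.update Z i z) ∂D := by
    intro Z
    exact (lintegral_indicator_one (hS.preimage (measurable_update Z))).symm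
  simp only [e]
  rw [key _ hm]
  simp

/-- The perturbations for which expert `i` is the strict leader at cumulative losses `L`. -/
def leaderSet (L : Fin N → ℝ) (i : Fin N) : Set (Fin N → ℝ) :=
  {Z | ∀ j, j ≠ i → L i - Z i < L j - Z j}

lemma measurableSet_leaderSet (L : Fin N → ℝ) (i : Fin N) : MeasurableSet (leaderSet L i) := by
  simp only [leaderSet, Set.ofPred_forall]
  exact MeasurableSet.iInter fun j => MeasurableSet.iInter fun _ =>
    measurableSet_lt (by fun_prop) (by fun_prop)

lemma eq_of_mem_leaderSet {L Z : Fin N → ℝ} {i j : Fin N} (hi : Z ∈ leaderSet L i)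
    (hj : Z ∈ leaderSet L j) : i = j := by
  by_contra h
  exact lt_asymm (hi j (Ne.symm h)) (hj i h)

/-- Perturbations without atoms almost surely leave no ties. -/
lemma ae_exists_mem_leaderSet [NeZero N] (D : Measure ℝ) [IsProbabilityMeasure D]
    [NullSingletonClass D]
    (L : Fin N → ℝ) :
    ∀ᵐ Z ∂(Measure.pi fun _ : Fin N => D), ∃ i, Z ∈ leaderSet L i := by
  have hne : ∀ᵐ Z ∂(Measure.pi fun _ : Fin N => D), ∀ i j : Fin N, j ≠ i →
      L i - Z i ≠ L j - Z j := by
    simp only [ae_all_iff]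
    intro i j hji
    have hm : MeasurableSet {Z : Fin N → ℝ | L i - Z i = L j - Z j} :=
      measurableSet_eq_fun (by fun_prop) (by fun_prop)
    refine measure_mono_null (t := {Z : Fin N → ℝ | L i - Z i = L j - Z j}) (fun Z hZ => by
      simpa using hZ) ?_
    rw [pi_apply_eq_lintegral_update D i hm]
    have : ∀ Z : Fin N → ℝ,
        D {z | Function.update Z i z ∈ {Z : Fin N → ℝ | L i - Z i = L j - Z j}} = 0 := by
      intro Z
      refine measure_mono_null (t := {L i - (L j - Z j)}) (fun z hz => ?_) (measure_singleton _)
      simp only [Set.mem_ofPred_eq, Function.update_self, Function.update_of_ne hji] at hz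
      rw [Set.mem_singleton_iff]; linarith
    simp only [this, lintegral_zero]
  filter_upwards [hne] with Z hZ
  obtain ⟨i, hi⟩ := Finite.exists_min fun i => L i - Z i
  exact ⟨i, fun j hj => lt_of_le_of_ne (hi j) (hZ i j hj)⟩

/-! ### The potential -/

lemma iInf_sub_le (L Z : Fin N → ℝ) (i : Fin N) : ⨅ j, (L j - Z j) ≤ L i - Z i :=
  ciInf_le (Set.finite_range _).bddBelow i

lemma exists_iInf_sub_eq [NeZero N] (L Z : Fin N → ℝ) : ∃ i, L i - Z i = ⨅ j, (L j - Z j) :=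
  exists_eq_ciInf_of_finite

lemma lipschitzWith_iInf_sub [NeZero N] (Z : Fin N → ℝ) :
    LipschitzWith 1 fun L : Fin N → ℝ => ⨅ j, (L j - Z j) := by
  refine LipschitzWith.of_le_add fun L L' => ?_
  obtain ⟨i, hi⟩ := exists_iInf_sub_eq L' Z
  have h1 := iInf_sub_le L Z i
  have h2 := (le_abs_self _).trans ((Real.dist_eq _ _).symm.le.trans (dist_le_pi_dist L L' i))
  linarith

lemma integrable_eval {D : Measure ℝ} [IsProbabilityMeasure D] (hD : Integrable id D) (i : Fin N) :
    Integrable (fun Z : Fin N → ℝ => Z i) (Measure.pi fun _ : Fin N => D) :=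
  integrable_comp_eval (μ := fun _ : Fin N => D) hD

lemma integrable_iInf_sub [NeZero N] {D : Measure ℝ} [IsProbabilityMeasure D]
    (hD : Integrable id D) (L : Fin N → ℝ) :
    Integrable (fun Z : Fin N → ℝ => ⨅ j, (L j - Z j)) (Measure.pi fun _ : Fin N => D) := by
  have hs : Integrable (fun Z : Fin N → ℝ => ∑ i, |L i - Z i|) (Measure.pi fun _ : Fin N => D) :=
    integrable_finsetSum _ fun i _ => ((integrable_const _).sub (integrable_eval hD i)).abs
  refine hs.mono' (Measurable.iInf fun i => by fun_prop).aestronglyMeasurable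
    (ae_of_all _ fun Z => ?_)
  obtain ⟨i, hi⟩ := exists_iInf_sub_eq L Z
  rw [← hi, Real.norm_eq_abs]
  exact Finset.single_le_sum (f := fun i => |L i - Z i|) (fun _ _ => abs_nonneg _)
    (Finset.mem_univ i)

lemma hasFDerivAt_iInf_sub {L Z : Fin N → ℝ} {i : Fin N} (hZ : Z ∈ leaderSet L i) :
    HasFDerivAt (fun L : Fin N → ℝ => ⨅ j, (L j - Z j))
      (ContinuousLinearMap.proj i : (Fin N → ℝ) →L[ℝ] ℝ) L := by
  have hev : ∀ᶠ L' in 𝓝 L, ∀ j, j ≠ i → L' i - Z i < L' j - Z j := by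
    rw [eventually_all]
    intro j
    rw [eventually_imp_distrib_left]
    intro hj
    have h1 : Continuous fun L' : Fin N → ℝ => L' i - Z i := by fun_prop
    have h2 : Continuous fun L' : Fin N → ℝ => L' j - Z j := by fun_prop
    exact h1.continuousAt.eventually_lt h2.continuousAt (hZ j hj)
  have hd : HasFDerivAt (fun L' : Fin N → ℝ => L' i - Z i)
      (ContinuousLinearMap.proj i : (Fin N → ℝ) →L[ℝ] ℝ) L :=
    (ContinuousLinearMap.proj i : (Fin N → ℝ) →L[ℝ] ℝ).hasFDerivAt.sub_const (Z i)
  refine hd.congr_of_eventuallyEq ?_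
  filter_upwards [hev] with L' hL'
  have : Nonempty (Fin N) := ⟨i⟩
  refine le_antisymm (iInf_sub_le L' Z i) (le_ciInf fun j => ?_)
  rcases eq_or_ne j i with rfl | hj
  · exact le_rfl
  · exact (hL' j hj).le

lemma sum_indicator_leaderSet {L Z : Fin N → ℝ} {i : Fin N} (hZ : Z ∈ leaderSet L i)
    {E : Type*} [AddCommGroup E] [Module ℝ E] (v : Fin N → E) :
    ∑ j, (leaderSet L j).indicator (fun _ => (1 : ℝ)) Z • v j = v i := by
  rw [Finset.sum_eq_single i]
  · simp [hZ]
  · intro j _ hj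
    rw [Set.indicator_of_notMem (fun h => hj (eq_of_mem_leaderSet h hZ)), zero_smul]
  · simp

/-- The probability that expert `i` leads after the perturbation. -/
noncomputable def leaderProb (D : Measure ℝ) (L : Fin N → ℝ) (i : Fin N) : ℝ :=
  (Measure.pi fun _ : Fin N => D).real (leaderSet L i)

lemma integrable_indicator_leaderSet (D : Measure ℝ) [IsProbabilityMeasure D] (L : Fin N → ℝ)
    (i : Fin N) : Integrable ((leaderSet L i).indicator fun _ => (1 : ℝ))
      (Measure.pi fun _ : Fin N => D) :=
  (integrable_const _).indicator (measurableSet_leaderSet L i)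

lemma integral_indicator_leaderSet (D : Measure ℝ) (L : Fin N → ℝ) (i : Fin N) :
    ∫ Z, (leaderSet L i).indicator (fun _ => (1 : ℝ)) Z ∂(Measure.pi fun _ : Fin N => D) =
      leaderProb D L i := by
  rw [integral_indicator_const _ (measurableSet_leaderSet L i)]
  simp [leaderProb]

lemma integrable_sum_indicator_leaderSet (D : Measure ℝ) [IsProbabilityMeasure D] (L : Fin N → ℝ)
    {E : Type*} [NormedAddCommGroup E] [NormedSpace ℝ E] (v : Fin N → E) :
    Integrable (fun Z => ∑ i, (leaderSet L i).indicator (fun _ => (1 : ℝ)) Z • v i)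
      (Measure.pi fun _ : Fin N => D) :=
  integrable_finsetSum _ fun i _ => (integrable_indicator_leaderSet D L i).smul_const (v i)

lemma integral_sum_indicator_leaderSet (D : Measure ℝ) [IsProbabilityMeasure D] (L : Fin N → ℝ)
    {E : Type*} [NormedAddCommGroup E] [NormedSpace ℝ E] [CompleteSpace E] (v : Fin N → E) :
    ∫ Z, ∑ i, (leaderSet L i).indicator (fun _ => (1 : ℝ)) Z • v i
      ∂(Measure.pi fun _ : Fin N => D) = ∑ i, leaderProb D L i • v i := by
  rw [integral_finsetSum _ fun i _ => (integrable_indicator_leaderSet D L i).smul_const (v i)]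
  simp only [integral_smul_const, integral_indicator_leaderSet]

lemma sum_leaderProb [NeZero N] (D : Measure ℝ) [IsProbabilityMeasure D] [NullSingletonClass D]
    (L : Fin N → ℝ) : ∑ i, leaderProb D L i = 1 := by
  simp only [← integral_indicator_leaderSet]
  rw [← integral_finsetSum _ fun i _ => integrable_indicator_leaderSet D L i]
  rw [integral_congr_ae (g := fun _ => (1 : ℝ)) ?_]
  · simp
  · filter_upwards [ae_exists_mem_leaderSet D L] with Z ⟨i, hi⟩
    simpa using sum_indicator_leaderSet hi (fun _ => (1 : ℝ))

/-- The distribution that follow the perturbed leader plays at cumulative losses `L`. -/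
noncomputable def ftplGradient [NeZero N] (D : Measure ℝ) [IsProbabilityMeasure D]
    [NullSingletonClass D]
    (L : Fin N → ℝ) : stdSimplex ℝ (Fin N) :=
  ⟨leaderProb D L, fun _ => measureReal_nonneg, sum_leaderProb D L⟩

lemma concaveOn_iInf_sub [NeZero N] (Z : Fin N → ℝ) :
    ConcaveOn ℝ Set.univ fun L : Fin N → ℝ => ⨅ j, (L j - Z j) := by
  refine ⟨convex_univ, fun L _ L' _ a b ha hb hab => le_ciInf fun i => ?_⟩
  have h1 := mul_le_mul_of_nonneg_left (iInf_sub_le L Z i) ha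
  have h2 := mul_le_mul_of_nonneg_left (iInf_sub_le L' Z i) hb
  have h3 : Z i = a * Z i + b * Z i := by rw [← add_mul, hab, one_mul]
  simp only [smul_eq_mul, Pi.add_apply, Pi.smul_apply]
  linarith

/-- Differentiation under the expectation is legitimate since the minimum is `1`-Lipschitz in `L`
and, there being almost surely no ties, differentiable almost surely. -/
lemma hasFDerivAt_ftplPotential [NeZero N] (D : Measure ℝ) [IsProbabilityMeasure D]
    [NullSingletonClass D] (hD : Integrable id D) (L : Fin N → ℝ) :
    HasFDerivAt (ftplPotential N D)
      (∑ i, leaderProb D L i • (ContinuousLinearMap.proj i : (Fin N → ℝ) →L[ℝ] ℝ)) L := by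
  let π : Fin N → ((Fin N → ℝ) →L[ℝ] ℝ) := fun i => ContinuousLinearMap.proj i
  let F' : (Fin N → ℝ) → ((Fin N → ℝ) →L[ℝ] ℝ) := fun Z =>
    ∑ i, (leaderSet L i).indicator (fun _ => (1 : ℝ)) Z • π i
  have hF' : Integrable F' (Measure.pi fun _ : Fin N => D) :=
    integrable_sum_indicator_leaderSet D L π
  have hlip : ∀ᵐ Z : Fin N → ℝ ∂(Measure.pi fun _ : Fin N => D), LipschitzOnWith
      (Real.nnabs 1) (fun L : Fin N → ℝ => ⨅ j, (L j - Z j)) Set.univ :=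
    ae_of_all _ fun Z => by simpa using lipschitzWith_iInf_sub Z
  have hdiff : ∀ᵐ Z : Fin N → ℝ ∂(Measure.pi fun _ : Fin N => D),
      HasFDerivAt (fun L : Fin N → ℝ => ⨅ j, (L j - Z j)) (F' Z) L := by
    filter_upwards [ae_exists_mem_leaderSet D L] with Z ⟨i, hi⟩
    have e : F' Z = π i := sum_indicator_leaderSet hi π
    rw [e]
    exact hasFDerivAt_iInf_sub hi
  have hF : ∫ Z, F' Z ∂(Measure.pi fun _ : Fin N => D) = ∑ i, leaderProb D L i • π i :=
    integral_sum_indicator_leaderSet D L π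
  rw [← hF]
  exact (hasFDerivAt_integral_of_dominated_loc_of_lip univ_mem
    (Eventually.of_forall fun L => (integrable_iInf_sub hD L).1) (integrable_iInf_sub hD L)
    hF'.aestronglyMeasurable hlip (integrable_const _) hdiff).2

theorem isGBPAPotential_ftplPotential [NeZero N] (D : Measure ℝ) [IsProbabilityMeasure D]
    [NullSingletonClass D] (hD : Integrable id D) :
    IsGBPAPotential (ftplPotential N D) (ftplGradient D) where
  concave := by
    refine ⟨convex_univ, fun L _ L' _ a b ha hb hab => ?_⟩
    simp only [ftplPotential, smul_eq_mul]
    rw [← integral_const_mul, ← integral_const_mul,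
      ← integral_add ((integrable_iInf_sub hD L).const_mul a)
        ((integrable_iInf_sub hD L').const_mul b)]
    refine integral_mono (((integrable_iInf_sub hD L).const_mul a).add
        ((integrable_iInf_sub hD L').const_mul b)) (integrable_iInf_sub hD _) fun Z => ?_
    exact (concaveOn_iInf_sub Z).2 (Set.mem_univ L) (Set.mem_univ L') ha hb hab
  hasGradient := hasFDerivAt_ftplPotential D hD

/-- The gradient inequality of a concave potential. -/
lemma IsGBPAPotential.sum_mul_le {Φ : (Fin N → ℝ) → ℝ} {p : (Fin N → ℝ) → stdSimplex ℝ (Fin N)}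
    (h : IsGBPAPotential Φ p) (L v : Fin N → ℝ) :
    ∑ i, (p (L + v) : Fin N → ℝ) i * v i ≤ Φ (L + v) - Φ L := by
  set A : ℝ →ᵃ[ℝ] (Fin N → ℝ) := AffineMap.lineMap L (L + v) with hA
  have hc : ConcaveOn ℝ Set.univ (Φ ∘ A) := h.concave.comp_affineMap A
  have h1 : A 1 = L + v := AffineMap.lineMap_apply_one _ _
  have h0 : A 0 = L := AffineMap.lineMap_apply_zero _ _
  have hAd : HasDerivAt A v 1 := by
    have := AffineMap.hasDerivAt_lineMap (𝕜 := ℝ) (a := L) (b := L + v) (x := 1)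
    simpa using this
  have hd := (h1 ▸ h.hasGradient (L + v) : HasFDerivAt Φ _ (A 1)).comp_hasDerivAt (1 : ℝ) hAd
  have := hc.le_slope_of_hasDerivAt (Set.mem_univ 0) (Set.mem_univ 1) one_pos hd
  simpa [slope_def_field, h1, h0] using this

/-! ### Stability of follow the perturbed leader -/

/-- The properties of a perturbation `D` from which the regret bound follows: `1 - h` bounds the
factor by which the tail of `D` shrinks within a unit step, and `B` bounds the expected range
`𝔼 [max_i Z_i] - 𝔼 [Z_1]` of `N` perturbations, by means of
`max_i Z_i ≤ a + ∑ i, max (Z_i - a) 0`. -/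
structure IsStablePerturbation (N : ℕ) (D : Measure ℝ) (h B : ℝ) : Prop where
  isProbabilityMeasure : IsProbabilityMeasure D
  nullSingletonClass : NullSingletonClass D
  integrable : Integrable id D
  tail : ∀ c, ENNReal.ofReal (1 - h) * D (Set.Ioi c) ≤ D (Set.Ioi (c + 1))
  range : ∃ a, a + N * (∫ x, max (x - a) 0 ∂D) - ∫ x, x ∂D ≤ B

variable {D : Measure ℝ} {h B : ℝ}

/-- When the losses grow by at most `1`, the probability that `i` leads decreases at most by the
factor `1 - h`: conditionally on the other perturbations, `i` leads when `Z i` exceeds a threshold,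
and the threshold increases by at most `1`. -/
lemma mul_leaderProb_le (hh : 0 ≤ h) [IsProbabilityMeasure D]
    (hD : ∀ c, ENNReal.ofReal (1 - h) * D (Set.Ioi c) ≤ D (Set.Ioi (c + 1)))
    (L : Fin N → ℝ) {v : Fin N → ℝ} (hv : ∀ i, v i ∈ Set.Icc (0 : ℝ) 1) (i : Fin N) :
    (1 - h) * leaderProb D L i ≤ leaderProb D (L + v) i := by
  have hle1 : ENNReal.ofReal (1 - h) ≤ 1 := by
    rw [← ENNReal.ofReal_one]; exact ENNReal.ofReal_le_ofReal (by linarith)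
  have hmem : ∀ (L Z : Fin N → ℝ) (z : ℝ), Function.update Z i z ∈ leaderSet L i ↔
      ∀ j, j ≠ i → L i - L j + Z j < z := by
    intro L Z z
    refine forall_congr' fun j => forall_congr' fun hj => ?_
    rw [Function.update_self, Function.update_of_ne hj]
    constructor <;> intro h <;> linarith
  have key : ∀ Z : Fin N → ℝ, ENNReal.ofReal (1 - h) * D {z | Function.update Z i z ∈ leaderSet L i}
      ≤ D {z | Function.update Z i z ∈ leaderSet (L + v) i} := by
    intro Z
    simp only [hmem]
    rcases (Finset.univ.erase i).eq_empty_or_nonempty with he | hne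
    · have hall : ∀ j, j = i := fun j => by
        by_contra hj
        exact Finset.notMem_empty j (he ▸ Finset.mem_erase.2 ⟨hj, Finset.mem_univ j⟩)
      have : {z : ℝ | ∀ j, j ≠ i → (L + v) i - (L + v) j + Z j < z} = Set.univ :=
        Set.eq_univ_of_forall fun z j hj => absurd (hall j) hj
      rw [this, measure_univ]
      exact mul_le_one' hle1 prob_le_one
    · obtain ⟨k, hk, hmax⟩ := Finset.exists_max_image _ (fun j => L i - L j + Z j) hne
      calc ENNReal.ofReal (1 - h) * D {z | ∀ j, j ≠ i → L i - L j + Z j < z}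
          ≤ ENNReal.ofReal (1 - h) * D (Set.Ioi (L i - L k + Z k)) := by
            gcongr
            exact fun z hz => hz k (Finset.ne_of_mem_erase hk)
        _ ≤ D (Set.Ioi (L i - L k + Z k + 1)) := hD _
        _ ≤ _ := by
            refine measure_mono fun z hz j hj => ?_
            have h1 := hmax j (Finset.mem_erase.2 ⟨hj, Finset.mem_univ j⟩)
            have h2 := (hv i).2
            have h3 := (hv j).1
            have h4 : L i - L k + Z k + 1 < z := hz
            simp only [Pi.add_apply]
            linarith
  have hmeas : ENNReal.ofReal (1 - h) * (Measure.pi fun _ : Fin N => D) (leaderSet L i) ≤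
      (Measure.pi fun _ : Fin N => D) (leaderSet (L + v) i) := by
    rw [pi_apply_eq_lintegral_update D i (measurableSet_leaderSet L i),
      pi_apply_eq_lintegral_update D i (measurableSet_leaderSet (L + v) i),
      ← lintegral_const_mul' _ _ ENNReal.ofReal_ne_top]
    exact lintegral_mono key
  have := ENNReal.toReal_mono (measure_ne_top _ _) hmeas
  rw [ENNReal.toReal_mul] at this
  refine le_trans (mul_le_mul_of_nonneg_right ?_ measureReal_nonneg) this
  rw [ENNReal.toReal_ofReal']
  exact le_max_left _ _

lemma learnerLoss_gbpa_succ (p : (Fin N → ℝ) → stdSimplex ℝ (Fin N)) (T : ℕ)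
    (l : ℕ → Fin N → ℝ) :
    learnerLoss (gbpa p) (T + 1) l = learnerLoss (gbpa p) T l +
      ∑ i, (p (cumLoss T l) : Fin N → ℝ) i * l T i := by
  rw [learnerLoss, Finset.sum_range_succ]
  have e : ∑ s : Fin T, (fun s : Fin T => l s) s = cumLoss T l := by
    funext i
    rw [Finset.sum_apply, cumLoss, Finset.sum_range]
  simp only [gbpa, e]
  rfl

/-- By concavity each round increases the potential at least by the expected loss under the next
distribution, hence by stability at least by `1 - h` times the expected loss of the learner. -/
lemma mul_learnerLoss_le [NeZero N] (hh : 0 ≤ h) [IsProbabilityMeasure D] [NullSingletonClass D]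
    (hint : Integrable id D)
    (hD : ∀ c, ENNReal.ofReal (1 - h) * D (Set.Ioi c) ≤ D (Set.Ioi (c + 1)))
    {T : ℕ} {l : ℕ → Fin N → ℝ} (hl : IsLossSequence T l) :
    (1 - h) * learnerLoss (gbpa (ftplGradient D)) T l ≤
      ftplPotential N D (cumLoss T l) - ftplPotential N D 0 := by
  induction T with
  | zero =>
    have : cumLoss 0 l = 0 := by funext i; simp [cumLoss]
    simp [this, learnerLoss]
  | succ T ih =>
    have ih := ih fun t ht => hl t (ht.trans (Nat.lt_succ_self T))
    have hlT := hl T (Nat.lt_succ_self T)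
    have e : cumLoss (T + 1) l = cumLoss T l + l T := by
      funext i; simp [cumLoss, Finset.sum_range_succ]
    have hc := (isGBPAPotential_ftplPotential D hint).sum_mul_le (cumLoss T l) (l T)
    have hs : (1 - h) * ∑ i, (ftplGradient D (cumLoss T l) : Fin N → ℝ) i * l T i ≤
        ∑ i, (ftplGradient D (cumLoss T l + l T) : Fin N → ℝ) i * l T i := by
      rw [Finset.mul_sum]
      refine Finset.sum_le_sum fun i _ => ?_
      rw [← mul_assoc]
      exact mul_le_mul_of_nonneg_right (mul_leaderProb_le hh hD _ hlT i) (hlT i).1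
    rw [learnerLoss_gbpa_succ, mul_add, e]
    linarith

lemma ftplPotential_le [NeZero N] [IsProbabilityMeasure D] (hint : Integrable id D)
    (L : Fin N → ℝ) : ftplPotential N D L ≤ (⨅ i, L i) - ∫ x, x ∂D := by
  obtain ⟨i, hi⟩ := exists_eq_ciInf_of_finite (f := L)
  rw [← hi]
  have : ∫ Z : Fin N → ℝ, (L i - Z i) ∂(Measure.pi fun _ : Fin N => D) = L i - ∫ x, x ∂D := by
    rw [integral_sub (integrable_const _) (integrable_eval hint i),
      integral_comp_eval (μ := fun _ : Fin N => D) (i := i) (f := fun x => x) hint.1]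
    simp
  rw [← this]
  exact integral_mono (integrable_iInf_sub hint L)
    ((integrable_const _).sub (integrable_eval hint i)) fun Z => iInf_sub_le L Z i

lemma le_ftplPotential_zero [NeZero N] [IsProbabilityMeasure D] (hint : Integrable id D)
    (a : ℝ) : -(a + N * ∫ x, max (x - a) 0 ∂D) ≤ ftplPotential N D 0 := by
  have hm : Integrable (fun x => max (x - a) 0) D := (hint.sub (integrable_const a)).pos_part
  have hmi : ∀ i : Fin N, Integrable (fun Z : Fin N → ℝ => max (Z i - a) 0)
      (Measure.pi fun _ : Fin N => D) := fun i =>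
    integrable_comp_eval (μ := fun _ : Fin N => D) (i := i) hm
  have hs := (integrable_finsetSum Finset.univ fun i _ => hmi i)
  have : ∫ Z : Fin N → ℝ, -(a + ∑ i, max (Z i - a) 0) ∂(Measure.pi fun _ : Fin N => D) =
      -(a + N * ∫ x, max (x - a) 0 ∂D) := by
    rw [integral_neg, integral_add (integrable_const _) hs, integral_finsetSum _ fun i _ => hmi i]
    have : ∀ i : Fin N, ∫ Z : Fin N → ℝ, max (Z i - a) 0 ∂(Measure.pi fun _ : Fin N => D) =
        ∫ x, max (x - a) 0 ∂D := fun i =>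
      integral_comp_eval (μ := fun _ : Fin N => D) (i := i) (f := fun x => max (x - a) 0) hm.1
    simp [this]
  rw [← this]
  refine integral_mono ((integrable_const _).add hs).neg (integrable_iInf_sub hint 0) fun Z => ?_
  obtain ⟨i, hi⟩ := exists_iInf_sub_eq 0 Z
  have h1 := Finset.single_le_sum (f := fun i => max (Z i - a) 0) (fun _ _ => le_max_right _ _)
    (Finset.mem_univ i)
  have h2 := le_max_left (Z i - a) 0
  simp only [Pi.zero_apply] at hi ⊢
  rw [← hi]
  linarith

/-- The regret of follow the perturbed leader with a stable perturbation. -/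
theorem IsStablePerturbation.expectedRegret_le [NeZero N] (hs : IsStablePerturbation N D h B)
    (h0 : 0 ≤ h) (h2 : h ≤ 1 / 2) (hB : 0 ≤ B) :
    ∃ p : (Fin N → ℝ) → stdSimplex ℝ (Fin N), IsGBPAPotential (ftplPotential N D) p ∧
      ∀ (T : ℕ) (l : ℕ → Fin N → ℝ), IsLossSequence T l →
        expectedRegret (gbpa p) T l ≤ 2 * h * bestLoss T l + 2 * B := by
  have := hs.isProbabilityMeasure
  have := hs.nullSingletonClass
  refine ⟨ftplGradient D, isGBPAPotential_ftplPotential D hs.integrable, fun T l hl => ?_⟩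
  obtain ⟨a, ha⟩ := hs.range
  have h1 := mul_learnerLoss_le h0 hs.integrable hs.tail hl
  have h3 := ftplPotential_le hs.integrable (cumLoss T l)
  have h4 := le_ftplPotential_zero (N := N) hs.integrable a
  have h5 : ⨅ i, cumLoss T l i = bestLoss T l := rfl
  rw [h5] at h3
  set X := learnerLoss (gbpa (ftplGradient D)) T l with hX
  have hX0 : 0 ≤ X := Finset.sum_nonneg fun t ht => Finset.sum_nonneg fun i _ =>
    mul_nonneg (stdSimplex.zero_le _ _) (hl t (Finset.mem_range.1 ht) i).1
  rw [expectedRegret_eq, ← hX]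
  have h6 : (1 - h) * X ≤ bestLoss T l + B := by linarith
  -- `1 ≤ (1 + 2 * h) * (1 - h)` for `0 ≤ h ≤ 1 / 2`
  have h7 : X ≤ (1 + 2 * h) * (bestLoss T l + B) := by
    have h8 := mul_le_mul_of_nonneg_left h6 (by linarith : 0 ≤ 1 + 2 * h)
    have h9 : 0 ≤ h * (1 - 2 * h) * X := mul_nonneg (mul_nonneg h0 (by linarith)) hX0
    linarith
  have h8 : 2 * h * B ≤ 1 * B := mul_le_mul_of_nonneg_right (by linarith) hB
  linarith

end PerturbedLeader

section Families

open Filter Topology Set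

/-! ### Stability from a bounded hazard rate -/

variable {N : ℕ} {h : ℝ}

/-- A density `f` with hazard rate at most `h` loses at most the fraction `h` of its tail within a
unit step. -/
lemma tail_of_hazard {f : ℝ → ENNReal} [IsProbabilityMeasure (volume.withDensity f)]
    (h0 : 0 ≤ h) (h1 : h ≤ 1)
    (hf : ∀ x, f x ≤ ENNReal.ofReal h * volume.withDensity f (Ioi x)) (c : ℝ) :
    ENNReal.ofReal (1 - h) * volume.withDensity f (Ioi c) ≤
      volume.withDensity f (Ioi (c + 1)) := by
  set D := volume.withDensity f with hD
  have hle : D (Ioc c (c + 1)) ≤ ENNReal.ofReal h * D (Ioi c) := by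
    calc D (Ioc c (c + 1)) = ∫⁻ x in Ioc c (c + 1), f x := withDensity_apply _ measurableSet_Ioc
      _ ≤ ∫⁻ _ in Ioc c (c + 1), ENNReal.ofReal h * D (Ioi c) := by
        refine setLIntegral_mono' measurableSet_Ioc fun x hx => (hf x).trans ?_
        gcongr
        exact hx.1.le
      _ = ENNReal.ofReal h * D (Ioi c) := by simp
  have hsplit : D (Ioi c) = D (Ioc c (c + 1)) + D (Ioi (c + 1)) := by
    rw [← Ioc_union_Ioi_eq_Ioi (show c ≤ c + 1 by linarith)]
    exact measure_union (Ioc_disjoint_Ioi le_rfl) measurableSet_Ioi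
  have hsum : ENNReal.ofReal h * D (Ioi c) + ENNReal.ofReal (1 - h) * D (Ioi c) = D (Ioi c) := by
    rw [← add_mul, ← ENNReal.ofReal_add h0 (by linarith)]
    simp
  have hfin : ENNReal.ofReal h * D (Ioi c) ≠ ⊤ :=
    ENNReal.mul_ne_top ENNReal.ofReal_ne_top (measure_ne_top _ _)
  refine (ENNReal.add_le_add_iff_left hfin).1 ?_
  rw [hsum, hsplit]
  rw [hsplit] at hle
  gcongr

/-- Stability from a bound `h` on the hazard rate, a bound `K` on the expected excess above `a` and
a bound `M` on the expected negative part; the last two also give integrability. -/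
lemma isStablePerturbation_of_hazard {f : ℝ → ENNReal} {B a K M : ℝ}
    (hprob : IsProbabilityMeasure (volume.withDensity f)) (h0 : 0 ≤ h) (h1 : h ≤ 1)
    (hf : ∀ x, f x ≤ ENNReal.ofReal h * volume.withDensity f (Ioi x))
    (hK0 : 0 ≤ K) (hK : ∫⁻ x, ENNReal.ofReal (x - a) ∂(volume.withDensity f) ≤ ENNReal.ofReal K)
    (hM0 : 0 ≤ M) (hM : ∫⁻ x, ENNReal.ofReal (-x) ∂(volume.withDensity f) ≤ ENNReal.ofReal M)
    (hB : a + N * K + M ≤ B) : IsStablePerturbation N (volume.withDensity f) h B := by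
  have hle := tail_of_hazard h0 h1 hf
  set D := volume.withDensity f with hD
  have hmax : ∀ y : ℝ, ENNReal.ofReal (max y 0) = ENNReal.ofReal y := fun y => by
    rw [ENNReal.ofReal_max]; simp
  have hpos0 : 0 ≤ᵐ[D] fun x : ℝ => max (x - a) 0 := ae_of_all _ fun x => le_max_right _ _
  have hneg0 : 0 ≤ᵐ[D] fun x : ℝ => max (-x) 0 := ae_of_all _ fun x => le_max_right _ _
  have hposI : Integrable (fun x : ℝ => max (x - a) 0) D := by
    refine ⟨by fun_prop, ?_⟩
    rw [hasFiniteIntegral_iff_ofReal hpos0]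
    simp only [hmax]
    exact hK.trans_lt ENNReal.ofReal_lt_top
  have hnegI : Integrable (fun x : ℝ => max (-x) 0) D := by
    refine ⟨by fun_prop, ?_⟩
    rw [hasFiniteIntegral_iff_ofReal hneg0]
    simp only [hmax]
    exact hM.trans_lt ENNReal.ofReal_lt_top
  have hint : Integrable id D := by
    refine ((hposI.add hnegI).add (integrable_const |a|)).mono' measurable_id.aestronglyMeasurable
      (ae_of_all _ fun x => ?_)
    simp only [Pi.add_apply, id, Real.norm_eq_abs]
    have h2 := le_max_left (x - a) 0
    have h3 := le_max_right (x - a) 0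
    have h4 := le_max_left (-x) 0
    have h5 := le_max_right (-x) 0
    have h6 := le_abs_self a
    have h7 := abs_nonneg a
    exact abs_le.2 ⟨by linarith, by linarith⟩
  refine ⟨hprob, ⟨fun x => ?_⟩, hint, hle, a, ?_⟩
  · exact withDensity_absolutelyContinuous _ _ (measure_singleton x)
  · have e1 : ∫ x, max (x - a) 0 ∂D ≤ K := by
      rw [integral_eq_lintegral_of_nonneg_ae hpos0 (by fun_prop)]
      simp only [hmax]
      exact ENNReal.toReal_le_of_le_ofReal hK0 hK
    have e2 : ∫ x, max (-x) 0 ∂D ≤ M := by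
      rw [integral_eq_lintegral_of_nonneg_ae hneg0 (by fun_prop)]
      simp only [hmax]
      exact ENNReal.toReal_le_of_le_ofReal hM0 hM
    have e3 : -∫ x, max (-x) 0 ∂D ≤ ∫ x, x ∂D := by
      rw [← integral_neg]
      refine integral_mono hnegI.neg hint fun x => ?_
      have := le_max_left (-x) 0
      simp only
      linarith
    have e4 : N * ∫ x, max (x - a) 0 ∂D ≤ N * K := by gcongr
    linarith

/-! ### Tail integrals -/

lemma lintegral_Ioi_of_hasDerivAt {φ F : ℝ → ℝ} {c l : ℝ} (hcont : ContinuousWithinAt F (Ici c) c)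
    (hF : ∀ x ∈ Ioi c, HasDerivAt F (φ x) x) (hφ : ∀ x ∈ Ioi c, 0 ≤ φ x)
    (hl : Tendsto F atTop (𝓝 l)) :
    ∫⁻ x in Ioi c, ENNReal.ofReal (φ x) = ENNReal.ofReal (l - F c) := by
  rw [← integral_Ioi_of_hasDerivAt_of_nonneg hcont hF hφ hl,
    ofReal_integral_eq_lintegral_ofReal (integrableOn_Ioi_deriv_of_nonneg hcont hF hφ hl)]
  exact (ae_restrict_iff' measurableSet_Ioi).2 (ae_of_all _ hφ)

/-- The expected excess of `D` above `a`, from a bound `G` on its tail and a primitive `F` of `G`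
that vanishes at infinity. -/
lemma lintegral_ofReal_sub_le {D : Measure ℝ} {a : ℝ} {G F : ℝ → ℝ}
    (hF : ∀ x ∈ Ici a, HasDerivAt F (G x) x) (hG : ∀ x ∈ Ici a, 0 ≤ G x)
    (hl : Tendsto F atTop (𝓝 0)) (hD : ∀ x ∈ Ici a, D (Ioi x) ≤ ENNReal.ofReal (G x)) :
    ∫⁻ x, ENNReal.ofReal (x - a) ∂D ≤ ENNReal.ofReal (-F a) := by
  have hmax : ∀ y : ℝ, ENNReal.ofReal y = ENNReal.ofReal (max y 0) := fun y => by
    rw [ENNReal.ofReal_max]; simp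
  have hF' : ∀ t ∈ Ici (0 : ℝ), HasDerivAt (fun t => F (a + t)) (G (a + t)) t := fun t ht =>
    (hF (a + t) (mem_Ici.2 (le_add_of_nonneg_right ht))).comp_const_add a t
  calc ∫⁻ x, ENNReal.ofReal (x - a) ∂D
      = ∫⁻ t in Ioi 0, D {x | t < max (x - a) 0} := by
        simp only [hmax (_ - a)]
        exact lintegral_eq_lintegral_meas_lt D (ae_of_all _ fun x => le_max_right _ _)
          (by fun_prop)
    _ ≤ ∫⁻ t in Ioi 0, ENNReal.ofReal (G (a + t)) := by
        refine setLIntegral_mono' measurableSet_Ioi fun t ht => ?_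
        refine (measure_mono fun x hx => ?_).trans (hD (a + t) (le_add_of_nonneg_right ht.out.le))
        rcases lt_max_iff.1 (show t < max (x - a) 0 from hx) with h | h
        · exact mem_Ioi.2 (by linarith)
        · exact absurd h ht.out.not_gt
    _ = ENNReal.ofReal (0 - F (a + 0)) :=
        lintegral_Ioi_of_hasDerivAt (hF' 0 (mem_Ici.2 le_rfl)).continuousAt.continuousWithinAt
          (fun t ht => hF' t ht.out.le) (fun t ht => hG _ (le_add_of_nonneg_right ht.out.le))
          (hl.comp (tendsto_atTop_add_const_left _ a tendsto_id))
    _ = ENNReal.ofReal (-F a) := by simp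

lemma lintegral_ofReal_sub_le_of_exp_tail {D : Measure ℝ} {a : ℝ} (hh : 0 < h)
    (hD : ∀ x ∈ Ici a, D (Ioi x) ≤ ENNReal.ofReal (Real.exp (-(h * x)))) :
    ∫⁻ x, ENNReal.ofReal (x - a) ∂D ≤ ENNReal.ofReal (Real.exp (-(h * a)) / h) := by
  have hlim : Tendsto (fun x => -(Real.exp (-(h * x)) / h)) atTop (𝓝 0) := by
    have : Tendsto (fun x => Real.exp (-(h * x))) atTop (𝓝 0) :=
      Real.tendsto_exp_neg_atTop_nhds_zero.comp (tendsto_id.const_mul_atTop hh)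
    simpa using (this.div_const h).neg
  have := lintegral_ofReal_sub_le (D := D) (a := a) (G := fun x => Real.exp (-(h * x)))
    (F := fun x => -(Real.exp (-(h * x)) / h)) (fun x _ => ?_) (fun x _ => (Real.exp_pos _).le)
    hlim hD
  · simpa using this
  · have := ((((hasDerivAt_id x).const_mul h).neg).exp.div_const h).neg
    convert! this using 1
    simp only [id, Pi.neg_apply]
    field_simp

/-- The expected excess above `s * e` under a tail that decays like a power. -/
lemma lintegral_ofReal_sub_le_of_rpow_tail {D : Measure ℝ} {s α : ℝ} (hs : 0 < s) (hα : 1 < α)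
    (hD : ∀ x ∈ Ici (s * Real.exp 1), D (Ioi x) ≤ ENNReal.ofReal (s ^ α * x ^ (-α))) :
    ∫⁻ x, ENNReal.ofReal (x - s * Real.exp 1) ∂D ≤
      ENNReal.ofReal (s * Real.exp (1 - α) / (α - 1)) := by
  have ha : 0 < s * Real.exp 1 := by positivity
  have hα' : 0 < α - 1 := by linarith
  have hlim : Tendsto (fun x : ℝ => -(s ^ α * x ^ (-(α - 1)) / (α - 1))) atTop (𝓝 0) := by
    simpa using (((tendsto_rpow_neg_atTop hα').const_mul (s ^ α)).div_const (α - 1)).neg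
  refine (lintegral_ofReal_sub_le (G := fun x => s ^ α * x ^ (-α))
    (F := fun x => -(s ^ α * x ^ (-(α - 1)) / (α - 1))) (fun x hx => ?_) (fun x hx => ?_)
    hlim hD).trans_eq ?_
  · have hx0 : 0 < x := ha.trans_le hx
    have := (((Real.hasDerivAt_rpow_const (x := x) (p := -(α - 1)) (Or.inl hx0.ne')).const_mul
      (s ^ α)).div_const (α - 1)).neg
    convert! this using 1
    rw [show -(α - 1) - 1 = -α by ring]
    field_simp
  · have hx0 : 0 < x := ha.trans_le hx
    positivity
  · congr 1
    rw [neg_neg, Real.mul_rpow hs.le (Real.exp_pos _).le, ← Real.exp_mul, ← mul_assoc,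
      ← Real.rpow_add hs, show α + -(α - 1) = 1 by ring, Real.rpow_one,
      show 1 * -(α - 1) = 1 - α by ring]

lemma lintegral_ofReal_neg_le_of_nonneg {f : ℝ → ENNReal} (hf : ∀ x < 0, f x = 0) :
    ∫⁻ x, ENNReal.ofReal (-x) ∂(volume.withDensity f) ≤ ENNReal.ofReal 0 := by
  have h0 : volume.withDensity f (Iio 0) = 0 := by
    rw [withDensity_apply _ measurableSet_Iio, setLIntegral_congr_fun measurableSet_Iio
      (g := fun _ => 0) fun x hx => hf x hx]
    simp
  have hae : ∀ᵐ x ∂(volume.withDensity f), ENNReal.ofReal (-x) = 0 := by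
    refine measure_mono_null (fun x hx => ?_) h0
    by_contra hx'
    exact hx (ENNReal.ofReal_of_nonpos (by simpa using hx'))
  rw [lintegral_congr_ae hae]
  simp

/-! ### The tuned hazard rate -/

/-- The logarithmic factor of the rate, kept positive at `N = 1`. -/
noncomputable def logExperts (N : ℕ) : ℝ := Real.log (N + 1)

lemma two_div_three_le_logExperts (hN : 1 ≤ N) : 2 / 3 ≤ logExperts N := by
  have h1 : (2 : ℝ) ≤ N + 1 := by
    have : (1 : ℝ) ≤ N := by exact_mod_cast hN
    linarith
  have := Real.log_le_log (by norm_num) h1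
  have := Real.log_two_gt_d9
  rw [logExperts]; linarith

lemma natCast_mul_exp_neg_logExperts_le (N : ℕ) : N * Real.exp (-logExperts N) ≤ 1 := by
  have h1 : (0 : ℝ) < N + 1 := by positivity
  rw [logExperts, Real.exp_neg, Real.exp_log h1, ← div_eq_mul_inv, div_le_one h1]
  linarith

/-- The hazard rate at which the two terms of the regret bound balance. It is comparable with
`min 1 √(log N / L)`. -/
noncomputable def tunedHazard (N : ℕ) (L : ℝ) : ℝ :=
  √(logExperts N) / (√L + 2 * √(logExperts N))

lemma tunedHazard_pos (hN : 1 ≤ N) (L : ℝ) : 0 < tunedHazard N L := by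
  have h1 := two_div_three_le_logExperts hN
  have h2 : 0 < √(logExperts N) := Real.sqrt_pos.2 (by linarith)
  have h3 := Real.sqrt_nonneg L
  rw [tunedHazard]
  positivity

lemma tunedHazard_le (hN : 1 ≤ N) (L : ℝ) : tunedHazard N L ≤ 1 / 2 := by
  have h1 := two_div_three_le_logExperts hN
  have h2 : 0 < √(logExperts N) := Real.sqrt_pos.2 (by linarith)
  have h3 := Real.sqrt_nonneg L
  rw [tunedHazard, div_le_div_iff₀ (by positivity) (by norm_num)]
  linarith

lemma logExperts_le (hN : 2 ≤ N) : logExperts N ≤ 2 * Real.log N := by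
  have h1 : (2 : ℝ) ≤ N := by exact_mod_cast hN
  rw [logExperts, show 2 * Real.log N = Real.log ((N : ℝ) ^ 2) by rw [Real.log_pow]; norm_num]
  exact Real.log_le_log (by positivity) (by nlinarith)

lemma expectedRegret_of_subsingleton [NeZero N] (hN : N = 1) (A : ExpertsAlgorithm N) (T : ℕ)
    (l : ℕ → Fin N → ℝ) : expectedRegret A T l = 0 := by
  subst hN
  simp [expectedRegret, bestLoss]

/-- A perturbation whose hazard rate is tuned and whose range is of the order of `log N` divided by
the hazard rate achieves the first-order rate. -/
lemma ftplRegretAtMost_firstOrderRate {D : Measure ℝ} (hN : 1 ≤ N) {L : ℝ} (hL : 0 ≤ L)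
    (hD : IsStablePerturbation N D (tunedHazard N L) (32 * logExperts N / tunedHazard N L)) :
    FTPLRegretAtMost N D L (300 * firstOrderRate N L) := by
  have : NeZero N := ⟨by omega⟩
  have hh := tunedHazard_pos hN L
  have hg := two_div_three_le_logExperts hN
  have hg0 : 0 ≤ logExperts N := by linarith
  obtain ⟨p, hp, hreg⟩ := hD.expectedRegret_le hh.le (tunedHazard_le hN L)
    (div_nonneg (by linarith) hh.le)
  refine ⟨p, hp, fun T l hl hbest => ?_⟩
  rcases Nat.eq_or_lt_of_le hN with h1 | h1
  · rw [expectedRegret_of_subsingleton h1.symm, ← h1]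
    simp [firstOrderRate]
  · have hr := hreg T l hl
    rw [hbest] at hr
    refine hr.trans ?_
    have hgN := logExperts_le h1
    set y := √(logExperts N) with hy
    set x := √L with hx
    have hy0 : 0 < y := Real.sqrt_pos.2 (by linarith)
    have hx0 : 0 ≤ x := Real.sqrt_nonneg L
    have hyy : logExperts N = y ^ 2 := (Real.sq_sqrt hg0).symm
    have hxx : L = x ^ 2 := (Real.sq_sqrt hL).symm
    have hdef : tunedHazard N L = y / (x + 2 * y) := rfl
    have e1 : tunedHazard N L * L ≤ x * y := by
      rw [hdef, hxx, div_mul_eq_mul_div, div_le_iff₀ (by positivity)]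
      nlinarith [mul_nonneg hx0 hy0.le, mul_nonneg (mul_nonneg hx0 hy0.le) hy0.le]
    have e2 : 32 * logExperts N / tunedHazard N L = 32 * (x * y + 2 * y ^ 2) := by
      rw [hdef, hyy]; field_simp
    have e3 : x * y ≤ 2 * √(L * Real.log N) := by
      rw [hx, hy, ← Real.sqrt_mul hL, show (2 : ℝ) = √4 by
        rw [show (4 : ℝ) = 2 ^ 2 by norm_num, Real.sqrt_sq (by norm_num)],
        ← Real.sqrt_mul (by norm_num)]
      refine Real.sqrt_le_sqrt ?_
      have := mul_le_mul_of_nonneg_left hgN hL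
      have : 0 ≤ L * Real.log N := mul_nonneg hL (Real.log_natCast_nonneg N)
      linarith
    rw [e2, firstOrderRate]
    have := Real.sqrt_nonneg (L * Real.log N)
    have := Real.log_natCast_nonneg N
    rw [hyy] at hgN
    linarith

/-! ### Gamma and Weibull perturbations -/

/-- With shape `1` both families consist of the exponential distributions, whose hazard rate is
constant. -/
lemma gammaMeasure_one (h : ℝ) : gammaMeasure 1 h = volume.withDensity fun x =>
    ENNReal.ofReal (if 0 ≤ x then h * Real.exp (-(h * x)) else 0) := by
  rw [gammaMeasure]
  congr 1
  funext x
  simp [gammaPDF, gammaPDFReal]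

lemma weibullMeasure_inv_one (h : ℝ) : weibullMeasure h⁻¹ 1 = gammaMeasure 1 h := by
  rw [gammaMeasure_one, weibullMeasure]
  congr 1
  funext x
  simp [mul_comm]

lemma gammaMeasure_one_Ioi (hh : 0 < h) {x : ℝ} (hx : 0 ≤ x) :
    gammaMeasure 1 h (Ioi x) = ENNReal.ofReal (Real.exp (-(h * x))) := by
  have hder : ∀ y, HasDerivAt (fun y => -Real.exp (-(h * y))) (h * Real.exp (-(h * y))) y := by
    intro y
    convert! (((hasDerivAt_id y).const_mul h).neg).exp.neg using 1
    simp only [id, Pi.neg_apply]; ring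
  have hlim : Tendsto (fun x => -Real.exp (-(h * x))) atTop (𝓝 0) := by
    have : Tendsto (fun x => Real.exp (-(h * x))) atTop (𝓝 0) :=
      Real.tendsto_exp_neg_atTop_nhds_zero.comp (tendsto_id.const_mul_atTop hh)
    simpa using this.neg
  rw [gammaMeasure_one, withDensity_apply _ measurableSet_Ioi,
    setLIntegral_congr_fun measurableSet_Ioi
      (g := fun y => ENNReal.ofReal (h * Real.exp (-(h * y))))
      fun y hy => by simp only [if_pos (hx.trans hy.out.le)],
    lintegral_Ioi_of_hasDerivAt (hder x).continuousAt.continuousWithinAt (fun y _ => hder y)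
      (fun y _ => by positivity) hlim]
  simp

lemma isStablePerturbation_gammaMeasure (hN : 1 ≤ N) (hh : 0 < h) (h1 : h ≤ 1) :
    IsStablePerturbation N (gammaMeasure 1 h) h (32 * logExperts N / h) := by
  have hprob := isProbabilityMeasure_gammaMeasure one_pos hh
  have hIoi : ∀ x : ℝ, 0 ≤ x → gammaMeasure 1 h (Ioi x) = ENNReal.ofReal (Real.exp (-(h * x))) :=
    fun x => gammaMeasure_one_Ioi hh
  have hg := two_div_three_le_logExperts hN
  have ha : 0 ≤ logExperts N / h := div_nonneg (by linarith) hh.le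
  have hK := lintegral_ofReal_sub_le_of_exp_tail (D := gammaMeasure 1 h) (a := logExperts N / h) hh
    fun x hx => (hIoi x (ha.trans hx)).le
  rw [gammaMeasure_one] at hprob hIoi hK ⊢
  refine isStablePerturbation_of_hazard hprob hh.le h1 (fun x => ?_) (by positivity) hK le_rfl
    (lintegral_ofReal_neg_le_of_nonneg fun x hx => by simp [not_le.2 hx]) ?_
  · by_cases hx : 0 ≤ x
    · rw [hIoi x hx, if_pos hx, ENNReal.ofReal_mul hh.le]
    · simp [hx]
  · have e := natCast_mul_exp_neg_logExperts_le N
    rw [mul_div_cancel₀ _ hh.ne', ← mul_div_assoc, add_zero, ← add_div]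
    gcongr
    linarith

/-! ### Gumbel perturbations -/

lemma gumbelMeasure_zero_inv (h : ℝ) : gumbelMeasure 0 h⁻¹ = volume.withDensity fun x =>
    ENNReal.ofReal (h * (Real.exp (-(h * x)) * Real.exp (-Real.exp (-(h * x))))) := by
  rw [gumbelMeasure]
  congr 1
  funext x
  rw [← Real.exp_add, inv_inv, sub_zero, div_inv_eq_mul, mul_comm x h, neg_add]

lemma gumbelMeasure_Ioi (hh : 0 < h) (x : ℝ) :
    gumbelMeasure 0 h⁻¹ (Ioi x) = ENNReal.ofReal (1 - Real.exp (-Real.exp (-(h * x)))) := by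
  have hder : ∀ y, HasDerivAt (fun y => Real.exp (-Real.exp (-(h * y))))
      (h * (Real.exp (-(h * y)) * Real.exp (-Real.exp (-(h * y))))) y := by
    intro y
    convert! (((hasDerivAt_id y).const_mul h).neg).exp.neg.exp using 1
    simp only [id, Pi.neg_apply]; ring
  have hlim : Tendsto (fun x => Real.exp (-Real.exp (-(h * x)))) atTop (𝓝 1) := by
    have : Tendsto (fun x => Real.exp (-(h * x))) atTop (𝓝 0) :=
      Real.tendsto_exp_neg_atTop_nhds_zero.comp (tendsto_id.const_mul_atTop hh)
    simpa [Function.comp_def] using (Real.continuous_exp.tendsto _).comp this.neg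
  rw [gumbelMeasure_zero_inv, withDensity_apply _ measurableSet_Ioi]
  exact lintegral_Ioi_of_hasDerivAt (hder x).continuousAt.continuousWithinAt (fun y _ => hder y)
    (fun y _ => by positivity) hlim

lemma isProbabilityMeasure_gumbelMeasure (hh : 0 < h) :
    IsProbabilityMeasure (gumbelMeasure 0 h⁻¹) := by
  have : NullSingletonClass (gumbelMeasure 0 h⁻¹) := by rw [gumbelMeasure]; infer_instance
  have hIci : ∀ x, gumbelMeasure 0 h⁻¹ (Ici x) =
      ENNReal.ofReal (1 - Real.exp (-Real.exp (-(h * x)))) := fun x => by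
    rw [← measure_congr Ioi_ae_eq_Ici, gumbelMeasure_Ioi hh]
  refine ⟨tendsto_nhds_unique (tendsto_measure_Ici_atBot _) ?_⟩
  have h1 : Tendsto (fun x => h * -x) atBot atTop :=
    tendsto_neg_atBot_atTop.const_mul_atTop hh
  have h2 : Tendsto (fun x => Real.exp (-Real.exp (-(h * x)))) atBot (𝓝 0) := by
    refine Real.tendsto_exp_neg_atTop_nhds_zero.comp ?_
    refine (Real.tendsto_exp_atTop.comp h1).congr fun x => ?_
    simp
  simp only [hIci]
  have := ENNReal.tendsto_ofReal (h2.const_sub 1)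
  simpa using this

lemma isStablePerturbation_gumbelMeasure (hN : 1 ≤ N) (hh : 0 < h) (h1 : h ≤ 1) :
    IsStablePerturbation N (gumbelMeasure 0 h⁻¹) h (32 * logExperts N / h) := by
  have hprob := isProbabilityMeasure_gumbelMeasure hh
  have hIoi := gumbelMeasure_Ioi hh
  have hg := two_div_three_le_logExperts hN
  have hK := lintegral_ofReal_sub_le_of_exp_tail (D := gumbelMeasure 0 h⁻¹)
    (a := logExperts N / h) hh fun x _ => by
      rw [hIoi]
      refine ENNReal.ofReal_le_ofReal ?_
      have := Real.add_one_le_exp (-Real.exp (-(h * x)))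
      linarith
  have hM : ∫⁻ x, ENNReal.ofReal (-x) ∂(gumbelMeasure 0 h⁻¹) ≤ ENNReal.ofReal (1 / h) := by
    have hneg := lintegral_ofReal_sub_le_of_exp_tail (D := (gumbelMeasure 0 h⁻¹).map (fun x => -x))
      (a := 0) hh fun x _ => by
        rw [Measure.map_apply measurable_neg measurableSet_Ioi]
        refine (measure_mono (t := (Ioi (-x))ᶜ) fun y hy => ?_).trans ?_
        · simp only [mem_preimage, mem_Ioi, mem_compl_iff, not_lt] at hy ⊢
          linarith
        · rw [prob_compl_eq_one_sub measurableSet_Ioi, hIoi, ← ENNReal.ofReal_one,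
            ← ENNReal.ofReal_sub _ (by simp; positivity)]
          refine ENNReal.ofReal_le_ofReal ?_
          rw [sub_sub_cancel]
          refine Real.exp_le_exp.2 (neg_le_neg ?_)
          have := Real.add_one_le_exp (h * x)
          simp only [mul_neg, neg_neg]
          linarith
    rw [lintegral_map (by fun_prop) measurable_neg] at hneg
    simpa using hneg
  rw [gumbelMeasure_zero_inv] at hprob hIoi hK hM ⊢
  refine isStablePerturbation_of_hazard hprob hh.le h1 (fun x => ?_) (by positivity) hK
    (by positivity) hM ?_
  · rw [hIoi, ← ENNReal.ofReal_mul hh.le]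
    refine ENNReal.ofReal_le_ofReal (mul_le_mul_of_nonneg_left ?_ hh.le)
    -- `v * exp (-v) ≤ 1 - exp (-v)` follows from `v + 1 ≤ exp v`
    set v := Real.exp (-(h * x))
    have h2 := mul_le_mul_of_nonneg_right (Real.add_one_le_exp v) (Real.exp_pos (-v)).le
    rw [← Real.exp_add, add_neg_cancel, Real.exp_zero] at h2
    linarith
  · have e := natCast_mul_exp_neg_logExperts_le N
    rw [mul_div_cancel₀ _ hh.ne', ← mul_div_assoc, ← add_div, ← add_div]
    gcongr
    linarith

/-! ### Pareto and Fréchet perturbations -/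

/-- The shape of the heavy-tailed perturbations, chosen so that `N ^ (1 / α)` is bounded. -/
noncomputable def tailShape (N : ℕ) : ℝ := 2 + logExperts N

lemma heavyTail_range_le (hN : 1 ≤ N) {s B : ℝ} (hs : 0 < s) (hB : 4 * s ≤ B) :
    s * Real.exp 1 + N * (s * Real.exp (1 - tailShape N) / (tailShape N - 1)) + 0 ≤ B := by
  have hg := two_div_three_le_logExperts hN
  have e := natCast_mul_exp_neg_logExperts_le N
  have h1 : 1 ≤ tailShape N - 1 := by rw [tailShape]; linarith
  have h2 : s * Real.exp (1 - tailShape N) / (tailShape N - 1) ≤ s * Real.exp (-logExperts N) := by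
    refine (div_le_self (by positivity) h1).trans ?_
    gcongr
    rw [tailShape]; linarith
  have h3 : (N : ℝ) * (s * Real.exp (1 - tailShape N) / (tailShape N - 1)) ≤
      s * (N * Real.exp (-logExperts N)) := by
    calc _ ≤ N * (s * Real.exp (-logExperts N)) := by gcongr
      _ = _ := by ring
  have h4 := mul_le_mul_of_nonneg_left e hs.le
  have h5 := mul_le_mul_of_nonneg_left Real.exp_one_lt_d9.le hs.le
  linarith

lemma paretoMeasure_Ioi {s α : ℝ} (hs : 0 < s) (hα : 0 < α) {x : ℝ} (hx : s ≤ x) :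
    paretoMeasure s α (Ioi x) = ENNReal.ofReal (s ^ α * x ^ (-α)) := by
  have hder : ∀ y ∈ Ici x, HasDerivAt (fun y : ℝ => -(s ^ α * y ^ (-α)))
      (α * s ^ α * y ^ (-(α + 1))) y := by
    intro y hy
    have hy0 : 0 < y := hs.trans_le (hx.trans hy)
    convert! ((Real.hasDerivAt_rpow_const (x := y) (p := -α) (Or.inl hy0.ne')).const_mul
      (s ^ α)).neg using 1
    rw [show -α - 1 = -(α + 1) by ring]; ring
  have hlim : Tendsto (fun y : ℝ => -(s ^ α * y ^ (-α))) atTop (𝓝 0) := by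
    simpa using ((tendsto_rpow_neg_atTop hα).const_mul (s ^ α)).neg
  rw [paretoMeasure, withDensity_apply _ measurableSet_Ioi,
    setLIntegral_congr_fun measurableSet_Ioi fun y hy => paretoPDF_of_le (hx.trans hy.out.le),
    lintegral_Ioi_of_hasDerivAt (hder x self_mem_Ici).continuousAt.continuousWithinAt
      (fun y hy => hder y hy.out.le) (fun y hy => ?_) hlim]
  · simp
  · have hy0 : 0 < y := hs.trans_le (hx.trans hy.out.le)
    positivity

lemma isStablePerturbation_paretoMeasure (hN : 1 ≤ N) (hh : 0 < h) (h1 : h ≤ 1) :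
    IsStablePerturbation N (paretoMeasure (tailShape N / h) (tailShape N)) h
      (32 * logExperts N / h) := by
  have hg := two_div_three_le_logExperts hN
  have hα : 1 < tailShape N := by rw [tailShape]; linarith
  have hα0 : 0 < tailShape N := by linarith
  set s := tailShape N / h with hs_def
  have hs : 0 < s := by positivity
  have hprob := isProbabilityMeasure_paretoMeasure hs hα0
  have hIoi : ∀ x, s ≤ x → paretoMeasure s (tailShape N) (Ioi x) = _ :=
    fun x => paretoMeasure_Ioi hs hα0
  have hse : s ≤ s * Real.exp 1 := le_mul_of_one_le_right hs.le (Real.one_le_exp zero_le_one)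
  have hK := lintegral_ofReal_sub_le_of_rpow_tail hs hα fun x hx => (hIoi x (hse.trans hx)).le
  rw [paretoMeasure] at hprob hIoi hK ⊢
  refine isStablePerturbation_of_hazard hprob hh.le h1 (fun x => ?_)
    (div_nonneg (by positivity) (by linarith)) hK le_rfl
    (lintegral_ofReal_neg_le_of_nonneg fun x hx => paretoPDF_of_lt (hx.trans hs))
    (heavyTail_range_le hN hs ?_)
  · rcases lt_or_ge x s with hx | hx
    · rw [paretoPDF_of_lt hx]; exact zero_le
    · have hx0 : 0 < x := hs.trans_le hx
      rw [hIoi x hx, paretoPDF_of_le hx, ← ENNReal.ofReal_mul hh.le]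
      refine ENNReal.ofReal_le_ofReal ?_
      have e : x ^ (-(tailShape N + 1)) = x ^ (-tailShape N) / x := by
        rw [show -(tailShape N + 1) = -tailShape N - 1 by ring, Real.rpow_sub_one hx0.ne']
      have h2 : tailShape N / x ≤ h := by
        rw [div_le_iff₀ hx0, ← div_le_iff₀' hh]; exact hx
      rw [e]
      calc tailShape N * s ^ tailShape N * (x ^ (-tailShape N) / x)
          = tailShape N / x * (s ^ tailShape N * x ^ (-tailShape N)) := by ring
        _ ≤ h * (s ^ tailShape N * x ^ (-tailShape N)) := by gcongr
  · rw [hs_def, ← mul_div_assoc]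
    refine div_le_div_of_nonneg_right ?_ hh.le
    rw [tailShape]; linarith

/-- The distribution function of the Fréchet distribution. -/
noncomputable def frechetCDF (α s x : ℝ) : ℝ :=
  if 0 < x then Real.exp (-(x / s) ^ (-α)) else 0

lemma continuousWithinAt_frechetCDF {α s : ℝ} (hα : 0 < α) (hs : 0 < s) :
    ContinuousWithinAt (frechetCDF α s) (Ici 0) 0 := by
  have h0 : frechetCDF α s 0 = 0 := by simp [frechetCDF]
  rw [ContinuousWithinAt, h0]
  have hlim : Tendsto (fun x : ℝ => (x / s) ^ α) (𝓝[Ici 0] 0) (𝓝 0) := by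
    have hc : ContinuousAt (fun x : ℝ => (x / s) ^ α) 0 :=
      (continuousAt_id.div_const s).rpow_const (Or.inr hα.le)
    have := hc.tendsto
    simp only [zero_div, Real.zero_rpow hα.ne'] at this
    exact this.mono_left nhdsWithin_le_nhds
  refine tendsto_of_tendsto_of_tendsto_of_le_of_le' tendsto_const_nhds hlim
    (Eventually.of_forall fun x => ?_) (eventually_nhdsWithin_of_forall fun x hx => ?_)
  · simp only [frechetCDF]; split_ifs <;> positivity
  · have hx0 : 0 ≤ x := hx
    simp only [frechetCDF]
    split_ifs with hx1
    · have hu : 0 < x / s := by positivity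
      have hv : 0 < (x / s) ^ (-α) := Real.rpow_pos_of_pos hu _
      -- `exp (-v) ≤ v⁻¹`
      rw [Real.exp_neg, ← inv_inv ((x / s) ^ α), ← Real.rpow_neg hu.le]
      refine inv_anti₀ hv ?_
      have := Real.add_one_le_exp ((x / s) ^ (-α))
      linarith
    · positivity

lemma tendsto_frechetCDF_atTop {α s : ℝ} (hα : 0 < α) (hs : 0 < s) :
    Tendsto (frechetCDF α s) atTop (𝓝 1) := by
  have h1 : Tendsto (fun x : ℝ => (x / s) ^ (-α)) atTop (𝓝 0) :=
    (tendsto_rpow_neg_atTop hα).comp (tendsto_id.atTop_div_const hs)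
  have h2 : Tendsto (fun x : ℝ => Real.exp (-(x / s) ^ (-α))) atTop (𝓝 1) := by
    simpa [Function.comp_def] using (Real.continuous_exp.tendsto _).comp h1.neg
  refine h2.congr' ?_
  filter_upwards [eventually_gt_atTop 0] with x hx
  simp [frechetCDF, hx]

lemma hasDerivAt_frechetCDF {α s x : ℝ} (hs : 0 < s) (hx : 0 < x) :
    HasDerivAt (frechetCDF α s)
      (α / s * (x / s) ^ (-α - 1) * Real.exp (-(x / s) ^ (-α))) x := by
  have hu : x / s ≠ 0 := by positivity
  have hd : HasDerivAt (fun x : ℝ => Real.exp (-(x / s) ^ (-α)))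
      (α / s * (x / s) ^ (-α - 1) * Real.exp (-(x / s) ^ (-α))) x := by
    convert! (((hasDerivAt_id x).div_const s).rpow_const (p := -α) (Or.inl hu)).neg.exp using 1
    simp only [id, Pi.neg_apply]; ring
  refine hd.congr_of_eventuallyEq ?_
  filter_upwards [lt_mem_nhds hx] with y hy
  simp [frechetCDF, hy]

lemma frechetMeasure_Ioi {α s : ℝ} (hα : 0 < α) (hs : 0 < s) {x : ℝ} (hx : 0 ≤ x) :
    frechetMeasure α s (Ioi x) = ENNReal.ofReal (1 - frechetCDF α s x) := by
  rw [frechetMeasure, withDensity_apply _ measurableSet_Ioi]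
  have hcont : ContinuousWithinAt (frechetCDF α s) (Ici x) x := by
    rcases hx.eq_or_lt with rfl | hx
    · exact continuousWithinAt_frechetCDF hα hs
    · exact (hasDerivAt_frechetCDF hs hx).continuousAt.continuousWithinAt
  refine lintegral_Ioi_of_hasDerivAt hcont (fun y hy => ?_) (fun y hy => ?_)
    (tendsto_frechetCDF_atTop hα hs)
  · have hy0 : 0 < y := hx.trans_lt hy
    rw [if_pos hy0]
    exact hasDerivAt_frechetCDF hs hy0
  · have hy0 : 0 < y := hx.trans_lt hy
    rw [if_pos hy0]
    positivity

lemma isProbabilityMeasure_frechetMeasure {α s : ℝ} (hα : 0 < α) (hs : 0 < s) :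
    IsProbabilityMeasure (frechetMeasure α s) := by
  constructor
  have h0 : frechetMeasure α s (Iic 0) = 0 := by
    rw [frechetMeasure, withDensity_apply _ measurableSet_Iic,
      setLIntegral_congr_fun measurableSet_Iic (g := fun _ => 0) fun x hx => by
        simp [not_lt.2 (mem_Iic.1 hx)]]
    simp
  rw [← measure_add_measure_compl (s := Iic (0 : ℝ)) measurableSet_Iic, h0, compl_Iic,
    frechetMeasure_Ioi hα hs le_rfl]
  simp [frechetCDF]

/-- The bound on the hazard rate of the Fréchet distribution, with `v = u ^ (-α)`. -/
lemma rpow_mul_exp_neg_le {α u : ℝ} (hα : 1 < α) (hu : 0 < u) :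
    u ^ (-α - 1) * Real.exp (-u ^ (-α)) ≤ 2 * (1 - Real.exp (-u ^ (-α))) := by
  rw [Real.rpow_sub_one hu.ne']
  set v := u ^ (-α) with hv
  have hv0 : 0 < v := Real.rpow_pos_of_pos hu _
  have key : v / u ≤ 2 * (Real.exp v - 1) := by
    rcases le_total 1 u with h | h
    · have := Real.add_one_le_exp v
      have := div_le_self hv0.le h
      linarith
    · have h1 : u⁻¹ ≤ v := by
        rw [hv, ← Real.rpow_neg_one]
        exact Real.rpow_le_rpow_of_exponent_ge hu h (by linarith)
      have h2 := Real.quadratic_le_exp_of_nonneg hv0.le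
      rw [div_eq_mul_inv]
      have h3 := mul_le_mul_of_nonneg_left h1 hv0.le
      nlinarith
  have h4 := mul_le_mul_of_nonneg_right key (Real.exp_pos (-v)).le
  have h5 : Real.exp v * Real.exp (-v) = 1 := by rw [← Real.exp_add]; simp
  linarith

lemma isStablePerturbation_frechetMeasure (hN : 1 ≤ N) (hh : 0 < h) (h1 : h ≤ 1) :
    IsStablePerturbation N (frechetMeasure (tailShape N) (2 * tailShape N / h)) h
      (32 * logExperts N / h) := by
  have hg := two_div_three_le_logExperts hN
  have hα : 1 < tailShape N := by rw [tailShape]; linarith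
  have hα0 : 0 < tailShape N := by linarith
  set α := tailShape N with hα_def
  set s := 2 * α / h with hs_def
  have hs : 0 < s := by positivity
  have hprob := isProbabilityMeasure_frechetMeasure hα0 hs
  have hIoi : ∀ x, 0 < x → frechetMeasure α s (Ioi x) =
      ENNReal.ofReal (1 - Real.exp (-(x / s) ^ (-α))) := fun x hx => by
    rw [frechetMeasure_Ioi hα0 hs hx.le, frechetCDF, if_pos hx]
  have hK := lintegral_ofReal_sub_le_of_rpow_tail (D := frechetMeasure α s) hs hα fun x hx => by
    have hx0 : 0 < x := lt_of_lt_of_le (by positivity) hx.out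
    rw [hIoi x hx0]
    refine ENNReal.ofReal_le_ofReal ?_
    have e : s ^ α * x ^ (-α) = (x / s) ^ (-α) := by
      rw [Real.div_rpow hx0.le hs.le, Real.rpow_neg hs.le α, div_inv_eq_mul, mul_comm]
    rw [e]
    have := Real.add_one_le_exp (-(x / s) ^ (-α))
    linarith
  rw [frechetMeasure] at hprob hIoi hK ⊢
  refine isStablePerturbation_of_hazard hprob hh.le h1 (fun x => ?_)
    (div_nonneg (by positivity) (by linarith)) hK le_rfl
    (lintegral_ofReal_neg_le_of_nonneg fun x hx => by simp [not_lt.2 hx.le])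
    (heavyTail_range_le hN hs ?_)
  · by_cases hx : 0 < x
    · rw [hIoi x hx, if_pos hx, ← ENNReal.ofReal_mul hh.le]
      refine ENNReal.ofReal_le_ofReal ?_
      have e : α / s = h / 2 := by rw [hs_def]; field_simp
      have := mul_le_mul_of_nonneg_left (rpow_mul_exp_neg_le hα (div_pos hx hs))
        (by positivity : 0 ≤ h / 2)
      rw [e]
      linarith
    · simp [hx]
  · rw [hs_def, ← mul_div_assoc]
    refine div_le_div_of_nonneg_right ?_ hh.le
    rw [hα_def, tailShape]; linarith

end Families

/-! ### The optimal first-order rate -/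

theorem theorem2 :
    -- the upper bound for each of the five perturbation families
    (∃ C : ℝ, 0 < C ∧ ∀ N : ℕ, 1 ≤ N → ∀ Lstar : ℝ, 0 ≤ Lstar →
      (∃ a r : ℝ, 0 < a ∧ 0 < r ∧
        FTPLRegretAtMost N (gammaMeasure a r) Lstar (C * firstOrderRate N Lstar)) ∧
      (∃ μ β : ℝ, 0 < β ∧
        FTPLRegretAtMost N (gumbelMeasure μ β) Lstar (C * firstOrderRate N Lstar)) ∧
      (∃ α s : ℝ, 1 < α ∧ 0 < s ∧
        FTPLRegretAtMost N (frechetMeasure α s) Lstar (C * firstOrderRate N Lstar)) ∧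
      (∃ s k : ℝ, 0 < s ∧ 0 < k ∧
        FTPLRegretAtMost N (weibullMeasure s k) Lstar (C * firstOrderRate N Lstar)) ∧
      (∃ x α : ℝ, 0 < x ∧ 0 < α ∧
        FTPLRegretAtMost N (paretoMeasure x α) Lstar (C * firstOrderRate N Lstar))) ∧
    -- the rate is optimal: no algorithm improves on it by more than a constant factor
    (∃ c : ℝ, 0 < c ∧ ∀ N : ℕ, 1 ≤ N → ∀ Lstar : ℝ, 0 ≤ Lstar →
      ∃ T₀ : ℕ, ∀ T : ℕ, T₀ ≤ T → ∀ A : ExpertsAlgorithm N,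
        ∃ l : ℕ → Fin N → ℝ, IsLossSequence T l ∧ bestLoss T l = Lstar ∧
          c * firstOrderRate N Lstar ≤ expectedRegret A T l) := by
  refine ⟨⟨300, by norm_num, fun N hN L hL => ?_⟩, 1 / 16, by norm_num, fun N hN L hL => ?_⟩
  · have hh := tunedHazard_pos hN L
    have h1 : tunedHazard N L ≤ 1 := (tunedHazard_le hN L).trans (by norm_num)
    have hg := two_div_three_le_logExperts hN
    have hα : 1 < tailShape N := by rw [tailShape]; linarith
    have hα0 : 0 < tailShape N := by linarith
    have hgamma := ftplRegretAtMost_firstOrderRate hN hL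
      (isStablePerturbation_gammaMeasure hN hh h1)
    exact ⟨⟨1, tunedHazard N L, one_pos, hh, hgamma⟩,
      ⟨0, (tunedHazard N L)⁻¹, by positivity, ftplRegretAtMost_firstOrderRate hN hL
        (isStablePerturbation_gumbelMeasure hN hh h1)⟩,
      ⟨tailShape N, 2 * tailShape N / tunedHazard N L, hα, by positivity,
        ftplRegretAtMost_firstOrderRate hN hL (isStablePerturbation_frechetMeasure hN hh h1)⟩,
      ⟨(tunedHazard N L)⁻¹, 1, by positivity, one_pos, by rwa [weibullMeasure_inv_one]⟩,
      ⟨tailShape N / tunedHazard N L, tailShape N, by positivity, hα0,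
        ftplRegretAtMost_firstOrderRate hN hL (isStablePerturbation_paretoMeasure hN hh h1)⟩⟩
  · have : NeZero N := ⟨by omega⟩
    exact exists_regret_ge hL
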